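/- Let $M$ be a smooth Riemannian manifold of dimension $n$, let $E\to M$ be a smooth real vector bundle of finite rank with a smooth fibre metric, and let $(A,\Phi)$ be a Yang–Mills–Higgs pair on $E$: $A$ is a smooth metric connection on $E$ with covariant derivative $\nabla$ and curvature $F(X,Y)=\nabla_X\nabla_Y-\nabla_Y\nabla_X-\nabla_{[X,Y]}$, an $\mathrm{End}(E)$-valued $2$-form, and $\Phi$ is a smooth section of $\mathrm{End}(E)$ (for instance of $\mathfrak{so}(E)$) such that $$d^*F=[d\Phi,\Phi],\qquad d^*d\Phi=0 .$$ Here $d\Phi=\nabla\Phi$ is the $\mathrm{End}(E)$-valued $1$-form given by the connection induced on $\mathrm{End}(E)$, forms are differentiated with this connection and the Levi-Civita connection of $M$, $d^*=-\sum_i\iota_{e_i}\nabla_{e_i}$ for a local orthonormal frame $(e_i)$, and $[d\Phi,\Phi](X)=[\nabla_X\Phi,\Phi]$, $[F,\Phi](X,Y)=[F(X,Y),\Phi]$ are commutators. With $|B|^2=\mathrm{tr}(B^{T}B)$ on $\mathrm{End}(E)$, norms are $|\alpha|^2=\sum_i|\alpha(e_i)|^2$ for $1$-forms, $|\omega|^2=\sum_{i<j}|\omega(e_i,e_j)|^2$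 for $2$-forms, and $|\nabla\beta|^2=\sum_i|\nabla_{e_i}\beta|^2$. Fix a constant $a>0$. Then at every point where $F\neq0$ the function $|F|$ is differentiable and $$|\nabla F|^2\ \ge\ \Bigl(1+\min\Bigl\{\tfrac12,\ \tfrac{a}{1+(n-2)a}\Bigr\}\Bigr)\,\bigl|d|F|\bigr|^2-a\,\bigl|[d\Phi,\Phi]\bigr|^2 ,$$ and at every point where $d\Phi\neq0$ the function $|d\Phi|$ is differentiable and $$|\nabla d\Phi|^2\ \ge\ \Bigl(1+\min\Bigl\{\tfrac1{n-1},\ \tfrac{a}{1+a}\Bigr\}\Bigr)\,\bigl|d|d\Phi|\bigr|^2-a\,\bigl|[F,\Phi]\bigr|^2 ,$$ where for $n=1$ the number $\tfrac1{n-1}$ is read as $+\infty$. (A point with $F\ne0$ exists only if $n\ge2$, and a point with $d\Phi\neq0$ only if $n\ge1$, so all constants make sense.) -/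

import Mathlib

open Bundle FiberBundle Set
open scoped Manifold ContDiff Topology

set_option maxSynthPendingDepth 3
set_option synthInstance.maxHeartbeats 200000
set_option maxHeartbeats 1000000

noncomputable section

namespace YangMillsHiggs

section HomConnection

variable {E : Type*} [NormedAddCommGroup E] [NormedSpace ℝ E]
  {H : Type*} [TopologicalSpace H] {I : ModelWithCorners ℝ E H}
  {M : Type*} [TopologicalSpace M] [ChartedSpace H M]
  {F : Type*} [NormedAddCommGroup F] [NormedSpace ℝ F]
  {V : M → Type*} [TopologicalSpace (TotalSpace F V)]
  [∀ x, AddCommGroup (V x)] [∀ x, Module ℝ (V x)]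
  [∀ x, TopologicalSpace (V x)]
  [∀ x, IsTopologicalAddGroup (V x)] [∀ x, ContinuousSMul ℝ (V x)]
  [FiberBundle F V]
  {G : Type*} [NormedAddCommGroup G] [NormedSpace ℝ G]
  {W : M → Type*} [TopologicalSpace (TotalSpace G W)]
  [∀ x, AddCommGroup (W x)] [∀ x, Module ℝ (W x)]
  [∀ x, TopologicalSpace (W x)]
  [∀ x, IsTopologicalAddGroup (W x)] [∀ x, ContinuousSMul ℝ (W x)]
  [FiberBundle G W]

/-- `(∇_X A) σ = ∇_X (A σ) - A (∇_X σ)`, for vector fields `X` and sections `σ`. -/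
def homCovAux (cov : CovariantDerivative I F V) (cov' : CovariantDerivative I G W)
    (A : Π x, V x →L[ℝ] W x) (X : Π x : M, TangentSpace I x) (σ : Π x, V x) (x : M) : W x :=
  cov' (fun y ↦ A y (σ y)) x (X x) - A x (cov σ x (X x))

variable (cov : CovariantDerivative I F V) (cov' : CovariantDerivative I G W)
  {A : Π x, V x →L[ℝ] W x} {x : M}

theorem homCovAux_tensorial₁ [IsManifold I 1 M] (σ : Π x, V x) :
    TensorialAt I E (homCovAux cov cov' A · σ x) x where
  smul _ _ := by simp [homCovAux, smul_sub]
  add _ _ := by simp [homCovAux]; abel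

variable [VectorBundle ℝ F V] [VectorBundle ℝ G W]

theorem homCovAux_tensorial₂
    (hA : MDifferentiableAt I (I.prod 𝓘(ℝ, F →L[ℝ] G))
      (fun y ↦ TotalSpace.mk' (F →L[ℝ] G) y (A y)) x) (X : Π x : M, TangentSpace I x) :
    TensorialAt I F (homCovAux cov cov' A X · x) x where
  smul {f σ} hf hσ := by
    have h₁ := cov'.isCovariantDerivativeOn.leibniz
      (hA.clm_bundle_apply (F₁ := F) (F₂ := G) hσ) hf (s := univ)
    have h₂ : (fun y ↦ A y ((f • σ) y)) = f • (fun y ↦ A y (σ y)) := by ext; simp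
    rw [homCovAux, h₂, h₁, cov.isCovariantDerivativeOn.leibniz hσ hf]
    simp [homCovAux]
    module
  add {σ τ} hσ hτ := by
    have h₁ := cov'.isCovariantDerivativeOn.add (hA.clm_bundle_apply (F₁ := F) (F₂ := G) hσ)
      (hA.clm_bundle_apply (F₁ := F) (F₂ := G) hτ) (s := univ)
    have h₂ : (fun y ↦ A y ((σ + τ) y)) = (fun y ↦ A y (σ y)) + (fun y ↦ A y (τ y)) := by
      ext; simp
    rw [homCovAux, h₂, h₁, cov.isCovariantDerivativeOn.add hσ hτ]
    simp [homCovAux]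
    module

variable [FiniteDimensional ℝ E] [FiniteDimensional ℝ F] [IsManifold I ∞ M]
  [ContMDiffVectorBundle 1 F V I]

open scoped Classical in
/-- The connection induced on the bundle `Hom(V, W)` by connections on `V` and on `W`:
`(∇_X A) σ = ∇_X (A σ) - A (∇_X σ)` for every `A` which is differentiable at the given point. -/
def homCov : CovariantDerivative I (F →L[ℝ] G) (fun x ↦ V x →L[ℝ] W x) where
  toFun A x :=
    if hA : MDifferentiableAt I (I.prod 𝓘(ℝ, F →L[ℝ] G))
        (fun y ↦ TotalSpace.mk' (F →L[ℝ] G) y (A y)) x then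
      TensorialAt.mkHom₂ (homCovAux cov cov' A · · x) x
        (fun σ _ ↦ homCovAux_tensorial₁ cov cov' σ)
        (fun X _ ↦ homCovAux_tensorial₂ cov cov' hA X)
    else 0
  isCovariantDerivativeOnUniv := by
    constructor
    · intro A B x hA hB _
      have hAB := mdifferentiableAt_add_section hA hB
      simp only [Pi.add_apply] at hAB ⊢
      rw [dif_pos hA, dif_pos hB, dif_pos hAB]
      ext X₀ v
      simp only [add_apply, TensorialAt.mkHom₂_apply_eq_extend]
      have hv : MDiffAt (T% (extend F v)) x := mdifferentiableAt_extend ..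
      have h := cov'.isCovariantDerivativeOn.add (hA.clm_bundle_apply (F₁ := F) (F₂ := G) hv)
        (hB.clm_bundle_apply (F₁ := F) (F₂ := G) hv) (s := univ)
      have h₂ : (fun y ↦ (A + B) y (extend F v y)) =
        (fun y ↦ A y (extend F v y)) + (fun y ↦ B y (extend F v y)) := by ext; simp
      simp only [homCovAux, h₂, h]
      simp
      module
    · intro A f x hA hf _
      have hfA := hf.smul_section hA
      rw [dif_pos hA, dif_pos hfA]
      ext X₀ v
      have hv : MDiffAt (T% (extend F v)) x := mdifferentiableAt_extend ..
      have h := cov'.isCovariantDerivativeOn.leibniz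
        (hA.clm_bundle_apply (F₁ := F) (F₂ := G) hv) hf (s := univ)
      have h₂ : (fun y ↦ (f • A) y (extend F v y)) = f • (fun y ↦ A y (extend F v y)) := by
        ext; simp
      simp only [add_apply, smul_apply,
        TensorialAt.mkHom₂_apply_eq_extend]
      simp only [homCovAux, h₂, h]
      simp
      module

theorem homCov_apply
    (hA : MDifferentiableAt I (I.prod 𝓘(ℝ, F →L[ℝ] G))
      (fun y ↦ TotalSpace.mk' (F →L[ℝ] G) y (A y)) x)
    (X₀ : TangentSpace I x) {σ : Π x, V x} (hσ : MDiffAt (T% σ) x) :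
    homCov cov cov' A x X₀ (σ x) = cov' (fun y ↦ A y (σ y)) x X₀ - A x (cov σ x X₀) := by
  have hX : MDiffAt (T% (extend E X₀ : Π y : M, TangentSpace I y)) x :=
    mdifferentiableAt_extend ..
  have h := TensorialAt.mkHom₂_apply (Φ := (homCovAux cov cov' A · · x))
    (fun σ _ ↦ homCovAux_tensorial₁ cov cov' σ)
    (fun X _ ↦ homCovAux_tensorial₂ cov cov' hA X) hX hσ
  simp only [homCov, dif_pos hA]
  simpa [homCovAux] using h

end HomConnection

section LeviCivita

variable {E : Type*} [NormedAddCommGroup E] [NormedSpace ℝ E]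
  {H : Type*} [TopologicalSpace H] {I : ModelWithCorners ℝ E H}
  {M : Type*} [TopologicalSpace M] [ChartedSpace H M] [IsManifold I ∞ M]
  [RiemannianBundle (fun x : M ↦ TangentSpace I x)]

/-- Right-hand side of the Koszul formula for `⟪∇_X Y, Z⟫` at `x`. -/
def koszul (X Y Z : Π x : M, TangentSpace I x) (x : M) : ℝ :=
  2⁻¹ * (mvfderiv I (fun y ↦ inner ℝ (Y y) (Z y)) x (X x)
    + mvfderiv I (fun y ↦ inner ℝ (X y) (Z y)) x (Y x)
    - mvfderiv I (fun y ↦ inner ℝ (X y) (Y y)) x (Z x)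
    + inner ℝ (VectorField.mlieBracket I X Y x) (Z x)
    - inner ℝ (VectorField.mlieBracket I X Z x) (Y x)
    - inner ℝ (VectorField.mlieBracket I Y Z x) (X x))

variable [IsContMDiffRiemannianBundle I 1 E (fun x : M ↦ TangentSpace I x)]
  {x : M} {X Y Z : Π x : M, TangentSpace I x}

theorem mdifferentiableAt_inner (hX : MDiffAt (T% X) x) (hY : MDiffAt (T% Y) x) :
    MDiffAt (fun y ↦ inner ℝ (X y) (Y y)) x :=
  MDifferentiableAt.inner_bundle (F := E) (E := fun x : M ↦ TangentSpace I x) hX hY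

variable [FiniteDimensional ℝ E]

theorem koszul_tensorial₁ (hY : MDiffAt (T% Y) x) (hZ : MDiffAt (T% Z) x) :
    TensorialAt I E (koszul · Y Z x) x where
  smul {f X} hf hX := by
    simp [koszul, real_inner_smul_left, inner_add_left,
      VectorField.mlieBracket_smul_left hf hX,
      mvfderiv_fun_mul hf (mdifferentiableAt_inner hX hY),
      mvfderiv_fun_mul hf (mdifferentiableAt_inner hX hZ)]
    simp only [real_inner_comm, real_inner_smul_left]
    ring
  add {X X'} hX hX' := by
    simp [koszul, inner_add_left, inner_add_right, VectorField.mlieBracket_add_left hX hX',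
      mvfderiv_fun_add (mdifferentiableAt_inner hX hY) (mdifferentiableAt_inner hX' hY),
      mvfderiv_fun_add (mdifferentiableAt_inner hX hZ) (mdifferentiableAt_inner hX' hZ)]
    ring

theorem koszul_tensorial₂ (hX : MDiffAt (T% X) x) (hY : MDiffAt (T% Y) x) :
    TensorialAt I E (koszul X Y · x) x where
  smul {f Z} hf hZ := by
    simp [koszul, real_inner_smul_right, real_inner_smul_left, inner_add_left,
      VectorField.mlieBracket_smul_right hf hZ,
      mvfderiv_fun_mul hf (mdifferentiableAt_inner hX hZ),
      mvfderiv_fun_mul hf (mdifferentiableAt_inner hY hZ)]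
    simp only [real_inner_comm]
    ring
  add {Z Z'} hZ hZ' := by
    simp [koszul, inner_add_left, inner_add_right, VectorField.mlieBracket_add_right hZ hZ',
      mvfderiv_fun_add (mdifferentiableAt_inner hX hZ) (mdifferentiableAt_inner hX hZ'),
      mvfderiv_fun_add (mdifferentiableAt_inner hY hZ) (mdifferentiableAt_inner hY hZ')]
    ring

theorem koszul_add (hX : MDiffAt (T% X) x) {Y' : Π x : M, TangentSpace I x}
    (hY : MDiffAt (T% Y) x) (hY' : MDiffAt (T% Y') x) (hZ : MDiffAt (T% Z) x) :
    koszul X (Y + Y') Z x = koszul X Y Z x + koszul X Y' Z x := by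
  simp [koszul, inner_add_left, inner_add_right, VectorField.mlieBracket_add_right hY hY',
      VectorField.mlieBracket_add_left hY hY',
      mvfderiv_fun_add (mdifferentiableAt_inner hX hY) (mdifferentiableAt_inner hX hY'),
      mvfderiv_fun_add (mdifferentiableAt_inner hY hZ) (mdifferentiableAt_inner hY' hZ)]
  ring

theorem koszul_smul (hX : MDiffAt (T% X) x) {f : M → ℝ} (hf : MDiffAt f x)
    (hY : MDiffAt (T% Y) x) (hZ : MDiffAt (T% Z) x) :
    koszul X (f • Y) Z x = f x * koszul X Y Z x + mvfderiv I f x (X x) * inner ℝ (Y x) (Z x) := by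
  simp [koszul, real_inner_smul_right, real_inner_smul_left, inner_add_left,
      VectorField.mlieBracket_smul_right hf hY, VectorField.mlieBracket_smul_left hf hY,
      mvfderiv_fun_mul hf (mdifferentiableAt_inner hX hY),
      mvfderiv_fun_mul hf (mdifferentiableAt_inner hY hZ)]
  simp only [real_inner_comm]
  ring


instance instFiniteDimensionalTangentSpace (x : M) : FiniteDimensional ℝ (TangentSpace I x) :=
  inferInstanceAs (FiniteDimensional ℝ E)

open scoped Classical in
/-- The Levi-Civita connection of the Riemannian manifold `M`: at a point where the vector field
`Y` is differentiable, `∇_X Y` is given by the Koszul formula. -/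
def leviCivita : CovariantDerivative I E (fun x : M ↦ TangentSpace I x) where
  toFun Y x :=
    if hY : MDiffAt (T% Y) x then
      ∑ i, (((ContinuousLinearMap.apply ℝ ℝ (stdOrthonormalBasis ℝ (TangentSpace I x) i)) ∘L
        TensorialAt.mkHom₂ (koszul · Y · x) x
          (fun _ hZ ↦ koszul_tensorial₁ hY hZ) (fun _ hX ↦ koszul_tensorial₂ hX hY)).smulRight
        (stdOrthonormalBasis ℝ (TangentSpace I x) i))
    else 0
  isCovariantDerivativeOnUniv := by
    constructor
    · intro Y Y' x hY hY' _
      have hYY := mdifferentiableAt_add_section hY hY'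
      simp only [Pi.add_apply] at hYY ⊢
      rw [dif_pos hY, dif_pos hY', dif_pos hYY, ← Finset.sum_add_distrib]
      ext X₀
      simp only [sum_apply]
      refine Finset.sum_congr rfl fun i _ ↦ ?_
      simp only [add_apply, ContinuousLinearMap.smulRight_apply, ContinuousLinearMap.comp_apply,
        ContinuousLinearMap.apply_apply, TensorialAt.mkHom₂_apply_eq_extend]
      rw [koszul_add (mdifferentiableAt_extend ..) hY hY' (mdifferentiableAt_extend ..), add_smul]
    · intro Y f x hY hf _
      have hfY := hf.smul_section hY
      rw [dif_pos hY, dif_pos hfY]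
      ext X₀
      simp only [sum_apply, add_apply, smul_apply, Finset.smul_sum]
      have h : Y x = ∑ i, inner ℝ (Y x) (stdOrthonormalBasis ℝ (TangentSpace I x) i) •
          stdOrthonormalBasis ℝ (TangentSpace I x) i := by
        conv_lhs => rw [← (stdOrthonormalBasis ℝ (TangentSpace I x)).sum_repr' (Y x)]
        simp only [real_inner_comm]
      rw [ContinuousLinearMap.smulRight_apply]
      conv_rhs => rw [h]
      rw [Finset.smul_sum, ← Finset.sum_add_distrib]
      refine Finset.sum_congr rfl fun i _ ↦ ?_
      simp only [ContinuousLinearMap.smulRight_apply, ContinuousLinearMap.comp_apply,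
        ContinuousLinearMap.apply_apply, TensorialAt.mkHom₂_apply_eq_extend]
      rw [koszul_smul (mdifferentiableAt_extend ..) hf hY (mdifferentiableAt_extend ..)]
      simp only [extend_apply_self]
      module

theorem inner_leviCivita (hX : MDiffAt (T% X) x) (hY : MDiffAt (T% Y) x) (hZ : MDiffAt (T% Z) x) :
    inner ℝ (leviCivita Y x (X x)) (Z x) = koszul X Y Z x := by
  have h := TensorialAt.mkHom₂_apply (Φ := (koszul · Y · x))
          (fun _ hZ ↦ koszul_tensorial₁ hY hZ) (fun _ hX ↦ koszul_tensorial₂ hX hY) hX hZ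
  rw [← h]
  conv_rhs => rw [← (stdOrthonormalBasis ℝ (TangentSpace I x)).sum_repr' (Z x)]
  simp only [leviCivita, dif_pos hY, sum_apply, sum_inner, map_sum]
  refine Finset.sum_congr rfl fun i _ ↦ ?_
  simp [real_inner_smul_left]
  ring

theorem leviCivita_torsion : (leviCivita (I := I) (M := M)).torsion = 0 := by
  rw [CovariantDerivative.torsion_eq_zero_iff]
  intro X Y x hX hY
  refine ext_inner_right ℝ fun Z₀ ↦ ?_
  have hZ : MDiffAt (T% (extend E Z₀ : Π y : M, TangentSpace I y)) x :=
    mdifferentiableAt_extend ..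
  have h₁ := inner_leviCivita hX hY hZ
  have h₂ := inner_leviCivita hY hX hZ
  rw [extend_apply_self] at h₁ h₂
  rw [inner_sub_left, h₁, h₂]
  have : VectorField.mlieBracket I Y X x = - VectorField.mlieBracket I X Y x := by
    rw [VectorField.mlieBracket_swap]; rfl
  simp only [koszul, this, real_inner_comm, inner_neg_left, extend_apply_self]
  ring

theorem leviCivita_metric (hX : MDiffAt (T% X) x) (hY : MDiffAt (T% Y) x)
    (hZ : MDiffAt (T% Z) x) :
    mvfderiv I (fun y ↦ inner ℝ (Y y) (Z y)) x (X x) =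
      inner ℝ (leviCivita Y x (X x)) (Z x) + inner ℝ (Y x) (leviCivita Z x (X x)) := by
  have : VectorField.mlieBracket I Z Y x = - VectorField.mlieBracket I Y Z x := by
    rw [VectorField.mlieBracket_swap]; rfl
  rw [real_inner_comm _ (Y x), inner_leviCivita hX hY hZ, inner_leviCivita hX hZ hY]
  simp only [koszul, this, real_inner_comm, inner_neg_right]
  ring

end LeviCivita

section Curvature

variable {E : Type*} [NormedAddCommGroup E] [NormedSpace ℝ E]
  {H : Type*} [TopologicalSpace H] {I : ModelWithCorners ℝ E H}
  {M : Type*} [TopologicalSpace M] [ChartedSpace H M]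
  {F : Type*} [NormedAddCommGroup F] [NormedSpace ℝ F]
  {V : M → Type*} [TopologicalSpace (TotalSpace F V)]
  [∀ x, NormedAddCommGroup (V x)] [∀ x, InnerProductSpace ℝ (V x)]
  [FiberBundle F V]

/-- `∇_X ∇_Y s - ∇_Y ∇_X s - ∇_[X,Y] s` at the point `x`. -/
def curvatureAux (cov : CovariantDerivative I F V) (X Y : Π x : M, TangentSpace I x)
    (s : Π x, V x) (x : M) : V x :=
  cov (fun y ↦ cov s y (Y y)) x (X x) - cov (fun y ↦ cov s y (X y)) x (Y x)
    - cov s x (VectorField.mlieBracket I X Y x)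

variable (cov : CovariantDerivative I F V) {x : M} {s : Π x, V x}
  {X Y : Π x : M, TangentSpace I x}

theorem curvatureAux_swap : curvatureAux cov X Y s x = - curvatureAux cov Y X s x := by
  rw [curvatureAux, curvatureAux, VectorField.mlieBracket_swap]
  simp
  abel

variable [VectorBundle ℝ F V]

theorem extend_eq_symmₗ (v : V x) {y : M} (hy : y ∈ (trivializationAt F V x).baseSet) :
    extend F v y = (trivializationAt F V x).symmₗ ℝ y
      ((trivializationAt F V x).linearMapAt ℝ x v) := by
  have hx : x ∈ (trivializationAt F V x).baseSet := mem_baseSet_trivializationAt' x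
  rw [(trivializationAt F V x).coe_linearMapAt_of_mem hx, extend,
    (trivializationAt F V x).symmₗ_apply hy]

variable [FiniteDimensional ℝ E] [IsManifold I ∞ M]

theorem curvatureAux_tensorial₁
    (hs : MDifferentiableAt I (I.prod 𝓘(ℝ, E →L[ℝ] F))
      (fun y ↦ (⟨y, cov s y⟩ : TotalSpace (E →L[ℝ] F) fun y ↦ TangentSpace I y →L[ℝ] V y)) x) :
    TensorialAt I E (curvatureAux cov · Y s x) x where
  smul {f X} hf hX := by
    have h₁ := cov.isCovariantDerivativeOn.leibniz
      (hs.clm_bundle_apply (F₁ := E) (F₂ := F) hX) hf (s := univ)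
    have h₂ : (fun y ↦ cov s y ((f • X) y)) = f • (fun y ↦ cov s y (X y)) := by ext; simp
    simp only [curvatureAux, h₂, h₁, VectorField.mlieBracket_smul_left hf hX]
    simp
    module
  add {X X'} hX hX' := by
    have h₁ := cov.isCovariantDerivativeOn.add
      (hs.clm_bundle_apply (F₁ := E) (F₂ := F) hX)
      (hs.clm_bundle_apply (F₁ := E) (F₂ := F) hX') (s := univ)
    have h₂ : (fun y ↦ cov s y ((X + X') y)) =
      (fun y ↦ cov s y (X y)) + (fun y ↦ cov s y (X' y)) := by ext; simp
    simp only [curvatureAux, h₂, h₁, VectorField.mlieBracket_add_left hX hX']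
    simp
    module

theorem curvatureAux_tensorial₂
    (hs : MDifferentiableAt I (I.prod 𝓘(ℝ, E →L[ℝ] F))
      (fun y ↦ (⟨y, cov s y⟩ : TotalSpace (E →L[ℝ] F) fun y ↦ TangentSpace I y →L[ℝ] V y)) x) :
    TensorialAt I E (curvatureAux cov X · s x) x where
  smul {f Y} hf hY := by
    rw [curvatureAux_swap, (curvatureAux_tensorial₁ cov hs).smul hf hY,
      curvatureAux_swap cov (X := X), smul_neg]
  add {Y Y'} hY hY' := by
    rw [curvatureAux_swap, (curvatureAux_tensorial₁ cov hs).add hY hY',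
      curvatureAux_swap cov (X := X), curvatureAux_swap cov (X := X)]
    abel

variable [T2Space M]

/-- A smooth connection maps local smooth sections to differentiable sections. -/
theorem mdifferentiableAt_cov [hcov : cov.ContMDiffCovariantDerivative ∞] {U : Set M}
    (hU : U ∈ 𝓝 x) (hs : CMDiff[U] ∞ (T% s)) :
    MDifferentiableAt I (I.prod 𝓘(ℝ, E →L[ℝ] F))
      (fun y ↦ (⟨y, cov s y⟩ : TotalSpace (E →L[ℝ] F) fun y ↦ TangentSpace I y →L[ℝ] V y)) x := by
  obtain ⟨f, -, hf⟩ := (SmoothBumpFunction.nhds_basis_tsupport (I := I) x).mem_iff.1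
    (interior_mem_nhds.2 hU)
  have hfs : CMDiff ∞ (T% ((f : M → ℝ) • s)) := by
    intro y
    by_cases hy : y ∈ tsupport f
    · exact (f.contMDiff y).smul_section (hs.contMDiffAt (mem_interior_iff_mem_nhds.1 (hf hy)))
    · refine (Bundle.contMDiff_zeroSection ℝ V y).congr_of_eventuallyEq ?_
      filter_upwards [(isClosed_tsupport f).isOpen_compl.mem_nhds hy] with z hz
      simp [image_eq_zero_of_notMem_tsupport hz]
      rfl
  have h := hcov.contMDiff.contMDiff (σ := (f : M → ℝ) • s) (by simpa using hfs.contMDiffOn)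
  have h := (h.contMDiffAt (x := x) Filter.univ_mem).mdifferentiableAt (by simp)
  refine h.congr_of_eventuallyEq ?_
  filter_upwards [f.eventuallyEq_one.eventuallyEq_nhds, eventually_mem_nhds_iff.2 hU] with y hy hyU
  have : cov s y = cov ((f : M → ℝ) • s) y := by
    refine cov.isCovariantDerivativeOn.congr_of_eventuallyEq (s := univ)
      ((hs.contMDiffAt hyU).mdifferentiableAt (by simp)) ((hfs y).mdifferentiableAt (by simp))
      Filter.univ_mem ?_
    filter_upwards [hy] with z hz
    simp [hz]
  rw [this]

variable [cov.ContMDiffCovariantDerivative ∞]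

theorem curvatureAux_add {t : Π x, V x} {U : Set M} (hU : U ∈ 𝓝 x)
    (hs : CMDiff[U] ∞ (T% s)) (ht : CMDiff[U] ∞ (T% t))
    (hX : MDiffAt (T% X) x) (hY : MDiffAt (T% Y) x) :
    curvatureAux cov X Y (s + t) x = curvatureAux cov X Y s x + curvatureAux cov X Y t x := by
  have hd {r : Π x, V x} (hr : CMDiff[U] ∞ (T% r)) {y : M} (hy : U ∈ 𝓝 y) : MDiffAt (T% r) y :=
    (hr.contMDiffAt hy).mdifferentiableAt (by simp)
  have key {Z Z' : Π x : M, TangentSpace I x} (hZ : MDiffAt (T% Z) x) :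
      cov (fun y ↦ cov (s + t) y (Z y)) x (Z' x) =
        cov (fun y ↦ cov s y (Z y)) x (Z' x) + cov (fun y ↦ cov t y (Z y)) x (Z' x) := by
    have hs' := (mdifferentiableAt_cov cov hU hs).clm_bundle_apply (F₁ := E) (F₂ := F) hZ
    have ht' := (mdifferentiableAt_cov cov hU ht).clm_bundle_apply (F₁ := E) (F₂ := F) hZ
    have hst := (mdifferentiableAt_cov cov hU (hs.add_section ht)).clm_bundle_apply
      (F₁ := E) (F₂ := F) hZ
    have h := cov.isCovariantDerivativeOn.add hs' ht' (s := univ)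
    rw [← add_apply, ← h]
    refine congrArg (fun L : TangentSpace I x →L[ℝ] V x ↦ L (Z' x))
      (cov.isCovariantDerivativeOn.congr_of_eventuallyEq (s := univ) hst
        (mdifferentiableAt_add_section hs' ht') Filter.univ_mem ?_)
    filter_upwards [eventually_mem_nhds_iff.2 hU] with y hy
    simp [cov.isCovariantDerivativeOn.add (hd hs hy) (hd ht hy) (s := univ)]
  rw [curvatureAux, key hY, key hX,
    cov.isCovariantDerivativeOn.add (hd hs hU) (hd ht hU) (s := univ)]
  simp only [curvatureAux, add_apply]
  abel

theorem curvatureAux_smul {U : Set M} (hU : U ∈ 𝓝 x) (c : ℝ)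
    (hs : CMDiff[U] ∞ (T% s)) (hX : MDiffAt (T% X) x) (hY : MDiffAt (T% Y) x) :
    curvatureAux cov X Y (c • s) x = c • curvatureAux cov X Y s x := by
  have hd {y : M} (hy : U ∈ 𝓝 y) : MDiffAt (T% s) y :=
    (hs.contMDiffAt hy).mdifferentiableAt (by simp)
  have hcs : CMDiff[U] ∞ (T% (c • s)) := contMDiffOn_const.smul_section hs
  have key {Z Z' : Π x : M, TangentSpace I x} (hZ : MDiffAt (T% Z) x) :
      cov (fun y ↦ cov (c • s) y (Z y)) x (Z' x) =
        c • cov (fun y ↦ cov s y (Z y)) x (Z' x) := by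
    have hs' := (mdifferentiableAt_cov cov hU hs).clm_bundle_apply (F₁ := E) (F₂ := F) hZ
    have hc' := (mdifferentiableAt_cov cov hU hcs).clm_bundle_apply (F₁ := E) (F₂ := F) hZ
    have h := cov.isCovariantDerivativeOn.smul_const c hs' (s := univ)
    rw [← smul_apply, ← h]
    refine congrArg (fun L : TangentSpace I x →L[ℝ] V x ↦ L (Z' x))
      (cov.isCovariantDerivativeOn.congr_of_eventuallyEq (s := univ) hc'
        (mdifferentiableAt_const.smul_section hs') Filter.univ_mem ?_)
    filter_upwards [eventually_mem_nhds_iff.2 hU] with y hy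
    simp [cov.isCovariantDerivativeOn.smul_const c (hd hy) (s := univ)]
  rw [curvatureAux, key hY, key hX, cov.isCovariantDerivativeOn.smul_const c (hd hU) (s := univ)]
  simp only [curvatureAux, smul_apply]
  module

theorem curvatureAux_congr {t : Π x, V x} {U : Set M} (hU : U ∈ 𝓝 x)
    (hs : CMDiff[U] ∞ (T% s)) (ht : CMDiff[U] ∞ (T% t)) (h : ∀ y ∈ U, s y = t y)
    (hX : MDiffAt (T% X) x) (hY : MDiffAt (T% Y) x) :
    curvatureAux cov X Y s x = curvatureAux cov X Y t x := by
  have hst {y : M} (hy : U ∈ 𝓝 y) : cov s y = cov t y :=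
    cov.isCovariantDerivativeOn.congr_of_eventuallyEq (s := univ)
      ((hs.contMDiffAt hy).mdifferentiableAt (by simp))
      ((ht.contMDiffAt hy).mdifferentiableAt (by simp)) Filter.univ_mem
      (Filter.eventually_of_mem hy h)
  have key {Z : Π x : M, TangentSpace I x} (hZ : MDiffAt (T% Z) x) :
      cov (fun y ↦ cov s y (Z y)) x = cov (fun y ↦ cov t y (Z y)) x := by
    refine cov.isCovariantDerivativeOn.congr_of_eventuallyEq (s := univ)
      ((mdifferentiableAt_cov cov hU hs).clm_bundle_apply (F₁ := E) (F₂ := F) hZ)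
      ((mdifferentiableAt_cov cov hU ht).clm_bundle_apply (F₁ := E) (F₂ := F) hZ)
      Filter.univ_mem ?_
    filter_upwards [eventually_mem_nhds_iff.2 hU] with y hy
    rw [hst hy]
  rw [curvatureAux, curvatureAux, key hX, key hY, hst hU]

variable [ContMDiffVectorBundle ∞ F V I]

theorem mdifferentiableAt_cov_extend (v : V x) :
    MDifferentiableAt I (I.prod 𝓘(ℝ, E →L[ℝ] F))
      (fun y ↦ (⟨y, cov (extend F v) y⟩ :
        TotalSpace (E →L[ℝ] F) fun y ↦ TangentSpace I y →L[ℝ] V y)) x := by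
  obtain ⟨U, hU, hs⟩ := exists_contMDiffOn_extend (k := ∞) I F v
  exact mdifferentiableAt_cov cov hU hs

/-- The value at `v` of the curvature, as a bilinear map in the tangent vectors. -/
def curvatureHom (x : M) (v : V x) : TangentSpace I x →L[ℝ] TangentSpace I x →L[ℝ] V x :=
  TensorialAt.mkHom₂ (curvatureAux cov · · (extend F v) x) x
    (fun _ _ ↦ curvatureAux_tensorial₁ cov (mdifferentiableAt_cov_extend cov v))
    (fun _ _ ↦ curvatureAux_tensorial₂ cov (mdifferentiableAt_cov_extend cov v))

theorem curvatureHom_add (v w : V x) :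
    curvatureHom cov x (v + w) = curvatureHom cov x v + curvatureHom cov x w := by
  obtain ⟨U₁, hU₁, hv⟩ := exists_contMDiffOn_extend (k := ∞) I F v
  obtain ⟨U₂, hU₂, hw⟩ := exists_contMDiffOn_extend (k := ∞) I F w
  obtain ⟨U₃, hU₃, hvw⟩ := exists_contMDiffOn_extend (k := ∞) I F (v + w)
  have hU₄ := (trivializationAt F V x).open_baseSet.mem_nhds (mem_baseSet_trivializationAt' x)
  set U := (U₁ ∩ U₂) ∩ (U₃ ∩ (trivializationAt F V x).baseSet)
  have hU : U ∈ 𝓝 x := Filter.inter_mem (Filter.inter_mem hU₁ hU₂) (Filter.inter_mem hU₃ hU₄)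
  have hv' := hv.mono (t := U) fun y hy ↦ hy.1.1
  have hw' := hw.mono (t := U) fun y hy ↦ hy.1.2
  ext X₀ Y₀
  simp only [curvatureHom, TensorialAt.mkHom₂_apply_eq_extend, add_apply]
  rw [← curvatureAux_add cov hU hv' hw' (mdifferentiableAt_extend ..)
    (mdifferentiableAt_extend ..)]
  refine curvatureAux_congr cov hU (hvw.mono fun y hy ↦ hy.2.1) (hv'.add_section hw')
    (fun y hy ↦ ?_) (mdifferentiableAt_extend ..) (mdifferentiableAt_extend ..)
  simp [extend_eq_symmₗ _ hy.2.2]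

theorem curvatureHom_smul (c : ℝ) (v : V x) :
    curvatureHom cov x (c • v) = c • curvatureHom cov x v := by
  obtain ⟨U₁, hU₁, hv⟩ := exists_contMDiffOn_extend (k := ∞) I F v
  obtain ⟨U₃, hU₃, hcv⟩ := exists_contMDiffOn_extend (k := ∞) I F (c • v)
  have hU₄ := (trivializationAt F V x).open_baseSet.mem_nhds (mem_baseSet_trivializationAt' x)
  set U := U₁ ∩ (U₃ ∩ (trivializationAt F V x).baseSet)
  have hU : U ∈ 𝓝 x := Filter.inter_mem hU₁ (Filter.inter_mem hU₃ hU₄)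
  have hv' := hv.mono (t := U) fun y hy ↦ hy.1
  ext X₀ Y₀
  simp only [curvatureHom, TensorialAt.mkHom₂_apply_eq_extend, smul_apply]
  rw [← curvatureAux_smul cov hU c hv' (mdifferentiableAt_extend ..)
    (mdifferentiableAt_extend ..)]
  refine curvatureAux_congr cov hU (hcv.mono fun y hy ↦ hy.2.1)
    (contMDiffOn_const.smul_section hv')
    (fun y hy ↦ ?_) (mdifferentiableAt_extend ..) (mdifferentiableAt_extend ..)
  simp [extend_eq_symmₗ _ hy.2.2]

variable [FiniteDimensional ℝ F]

/-- The curvature `F` of the connection `cov`, an `End V`-valued two-form: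
`F(X, Y) s = ∇_X ∇_Y s - ∇_Y ∇_X s - ∇_[X,Y] s`, the tangent vectors and the element of the
fibre being extended to local smooth sections in order to compute the right-hand side. -/
def curvature (x : M) : TangentSpace I x →L[ℝ] TangentSpace I x →L[ℝ] (V x →L[ℝ] V x) :=
  haveI : FiniteDimensional ℝ (V x) := VectorBundle.finiteDimensional ℝ F V x
  haveI : T2Space (TangentSpace I x) := inferInstanceAs (T2Space E)
  LinearMap.toContinuousBilinearMap <|
    LinearMap.mk₂ ℝ (fun X₀ Y₀ ↦ LinearMap.toContinuousLinearMap
        { toFun v := curvatureHom cov x v X₀ Y₀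
          map_add' v w := by simp [curvatureHom_add]
          map_smul' c v := by simp [curvatureHom_smul] })
      (fun X₀ X₀' Y₀ ↦ by ext v; simp) (fun c X₀ Y₀ ↦ by ext v; simp)
      (fun X₀ Y₀ Y₀' ↦ by ext v; simp) (fun c X₀ Y₀ ↦ by ext v; simp)

theorem curvature_apply (X₀ Y₀ : TangentSpace I x) (v : V x) :
    curvature cov x X₀ Y₀ v = curvatureAux cov (extend E X₀) (extend E Y₀) (extend F v) x := rfl

end Curvature

section Pairs

variable {E : Type*} [NormedAddCommGroup E] [NormedSpace ℝ E] [FiniteDimensional ℝ E]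
  {H : Type*} [TopologicalSpace H] {I : ModelWithCorners ℝ E H}
  {M : Type*} [TopologicalSpace M] [ChartedSpace H M] [IsManifold I ∞ M]
  [RiemannianBundle (fun x : M ↦ TangentSpace I x)]

section Codifferential

variable [IsContMDiffRiemannianBundle I 1 E (fun x : M ↦ TangentSpace I x)]
  {G : Type*} [NormedAddCommGroup G] [NormedSpace ℝ G]
  {U : M → Type*} [TopologicalSpace (TotalSpace G U)]
  [∀ x, AddCommGroup (U x)] [∀ x, Module ℝ (U x)]
  [∀ x, TopologicalSpace (U x)]
  [∀ x, IsTopologicalAddGroup (U x)] [∀ x, ContinuousSMul ℝ (U x)]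
  [FiberBundle G U] [VectorBundle ℝ G U]

/-- The covariant derivative `∇α` of a `U`-valued one-form `α`, for the connection induced by the
Levi-Civita connection and by a connection on `U`: `(∇_X α)(Y) = ∇_X (α(Y)) - α(∇_X Y)`.
A `k`-form is seen here as a one-form with values in the `(k-1)`-forms. -/
def formCov (cov : CovariantDerivative I G U) :
    CovariantDerivative I (E →L[ℝ] G) (fun x : M ↦ TangentSpace I x →L[ℝ] U x) :=
  homCov leviCivita cov

/-- The codifferential `d^* α = - ∑ i, ι_{e_i} ∇_{e_i} α`, for an orthonormal basis `e` of the
tangent space. -/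
def codifferential (cov : CovariantDerivative I G U) (α : Π x : M, TangentSpace I x →L[ℝ] U x)
    (x : M) : U x :=
  - ∑ i, formCov cov α x (stdOrthonormalBasis ℝ (TangentSpace I x) i)
    (stdOrthonormalBasis ℝ (TangentSpace I x) i)

end Codifferential

variable {F : Type*} [NormedAddCommGroup F] [NormedSpace ℝ F] [FiniteDimensional ℝ F]
  {V : M → Type*} [TopologicalSpace (TotalSpace F V)]
  [∀ x, NormedAddCommGroup (V x)] [∀ x, InnerProductSpace ℝ (V x)]
  [FiberBundle F V] [VectorBundle ℝ F V]

section Norms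

/-- The squared norm `∑ i, ξ(e_i)²` of a covector. -/
def covectorNormSq {x : M} (ξ : TangentSpace I x →L[ℝ] ℝ) : ℝ :=
  ∑ i, ξ (stdOrthonormalBasis ℝ (TangentSpace I x) i) ^ 2

variable (F)

/-- The squared norm `tr (Bᵀ B)` of an endomorphism `B` of a fibre. -/
def endNormSq {x : M} (B : V x →L[ℝ] V x) : ℝ :=
  haveI : FiniteDimensional ℝ (V x) := VectorBundle.finiteDimensional ℝ F V x
  ∑ i, ‖B (stdOrthonormalBasis ℝ (V x) i)‖ ^ 2

variable (I)

/-- The squared norm `∑ i, |α(e_i)|²` of an `End V`-valued one-form at a point. -/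
def oneFormNormSq {x : M} (α : TangentSpace I x → (V x →L[ℝ] V x)) : ℝ :=
  ∑ i, endNormSq F (α (stdOrthonormalBasis ℝ (TangentSpace I x) i))

/-- The squared norm `∑ i < j, |η(e_i, e_j)|²` of an `End V`-valued two-form at a point. -/
def twoFormNormSq {x : M} (η : TangentSpace I x → TangentSpace I x → (V x →L[ℝ] V x)) : ℝ :=
  2⁻¹ * ∑ i, ∑ j, endNormSq F (η (stdOrthonormalBasis ℝ (TangentSpace I x) i)
    (stdOrthonormalBasis ℝ (TangentSpace I x) j))

end Norms

variable [IsContMDiffRiemannianBundle I 1 E (fun x : M ↦ TangentSpace I x)]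
  [ContMDiffVectorBundle ∞ F V I]

/-- The connection induced on `End V`: `(∇_X B) s = ∇_X (B s) - B (∇_X s)`. -/
def endCov (A : CovariantDerivative I F V) :
    CovariantDerivative I (F →L[ℝ] F) (fun x : M ↦ V x →L[ℝ] V x) :=
  homCov A A

/-- The connection on `End V`-valued one-forms. -/
def oneFormCov (A : CovariantDerivative I F V) :
    CovariantDerivative I (E →L[ℝ] F →L[ℝ] F)
      (fun x : M ↦ TangentSpace I x →L[ℝ] V x →L[ℝ] V x) :=
  formCov (U := fun x : M ↦ V x →L[ℝ] V x) (endCov A)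

/-- The connection on `End V`-valued two-forms. -/
def twoFormCov (A : CovariantDerivative I F V) :
    CovariantDerivative I (E →L[ℝ] E →L[ℝ] F →L[ℝ] F)
      (fun x : M ↦ TangentSpace I x →L[ℝ] TangentSpace I x →L[ℝ] V x →L[ℝ] V x) :=
  formCov (U := fun x : M ↦ TangentSpace I x →L[ℝ] V x →L[ℝ] V x) (oneFormCov A)

/-- `|∇α|²` at `x`, for an `End V`-valued one-form `α`. -/
def gradOneFormNormSq (A : CovariantDerivative I F V)
    (α : Π x : M, TangentSpace I x →L[ℝ] V x →L[ℝ] V x) (x : M) : ℝ :=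
  ∑ i, oneFormNormSq I F
    (fun X ↦ oneFormCov A α x (stdOrthonormalBasis ℝ (TangentSpace I x) i) X)

/-- `|∇η|²` at `x`, for an `End V`-valued two-form `η`. -/
def gradTwoFormNormSq (A : CovariantDerivative I F V)
    (η : Π x : M, TangentSpace I x →L[ℝ] TangentSpace I x →L[ℝ] V x →L[ℝ] V x) (x : M) : ℝ :=
  ∑ i, twoFormNormSq I F
    (fun X Y ↦ twoFormCov A η x (stdOrthonormalBasis ℝ (TangentSpace I x) i) X Y)

variable [T2Space M] [IsContMDiffRiemannianBundle I 1 F V]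

/-- The pointwise norm `|F|` of the curvature `F` of `A`, as a function on `M`. -/
def curvatureNorm (A : CovariantDerivative I F V) [A.ContMDiffCovariantDerivative ∞] (x : M) : ℝ :=
  √(twoFormNormSq I F (fun X Y ↦ curvature A x X Y))

/-- The pointwise norm `|dΦ|` of the one-form `dΦ = ∇Φ`, as a function on `M`. -/
def higgsGradNorm (A : CovariantDerivative I F V) (Φ : Π x : M, V x →L[ℝ] V x) (x : M) : ℝ :=
  √(oneFormNormSq I F (fun X ↦ endCov A Φ x X))

/-- Yang-Mills-Higgs pairs on the Riemannian vector bundle `V`: a smooth metric connection `A` with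
curvature `F` and a smooth Higgs field `Φ`, a section of `End V`, satisfying the equations
`d^* F = [dΦ, Φ]` and `d^* dΦ = 0`. Skew-adjointness of `Φ` is not required, so that the Higgs
field may take values in any adjoint subbundle of `End V`. -/
structure IsYangMillsHiggsPair (A : CovariantDerivative I F V) [A.ContMDiffCovariantDerivative ∞]
    (Φ : Π x : M, V x →L[ℝ] V x) : Prop where
  metric : A.IsMetricCompatible
  smooth : ContMDiff I (I.prod 𝓘(ℝ, F →L[ℝ] F)) ∞
    (fun x ↦ (⟨x, Φ x⟩ : TotalSpace (F →L[ℝ] F) (fun x : M ↦ V x →L[ℝ] V x)))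
  codifferential_curvature : ∀ (x : M) (X : TangentSpace I x),
    codifferential (U := fun x : M ↦ TangentSpace I x →L[ℝ] V x →L[ℝ] V x)
      (oneFormCov A) (curvature A) x X = ⁅endCov A Φ x X, Φ x⁆
  codifferential_higgs : ∀ x : M,
    codifferential (endCov A) (endCov A Φ) x = 0

end Pairs

end YangMillsHiggs

open YangMillsHiggs

set_option linter.unusedSectionVars false

namespace YangMillsHiggs

/-! ### Linear algebra: changes of orthonormal basis and the Kato inequalities for arrays -/

section LinearAlgebra

/-! Fix a point and an orthonormal basis whose vector `i₀` points along the gradient of `|F|`. Then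
`|d|F||²` is the square of a single component, and Cauchy–Schwarz bounds it by `|∇_{i₀} F|²`. The
extra factor `1 + c` is gained by bounding `c |∇_{i₀} F|²` by the other derivatives `∇_i F`, `i ≠
i₀`, together with the source term.

The components of `∇_{i₀} F` are of two kinds. For `j, k ≠ i₀` the Bianchi identity gives `∇_{i₀}
F_{jk} = ∇_j F_{i₀k} - ∇_k F_{i₀j}`, which yields the constant `1/2`. For `F_{i₀k}` the equation for
`d^*F` gives `∇_{i₀} F_{i₀k}` as the source minus the `n - 2` terms `∇_i F_{ik}`, `i ≠ i₀, k`;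
Young's inequality, weighted by `a`, yields `a / (1 + (n-2)a)`. The two estimates draw on disjoint
components of the remaining derivatives, so they add up. For `dΦ` the scheme is the same: `d^*dΦ =
0` controls `∇_{i₀} ∇_{i₀} Φ`, and the Ricci identity `∇_i ∇_j Φ - ∇_j ∇_i Φ = [F_{ij}, Φ]` controls
`∇_{i₀} ∇_k Φ`. This algebra is in `kato_twoForm_of_array` and `kato_oneForm_of_array`.

Three geometric inputs remain. `curvature_apply_of_contMDiff` shows that the curvature may be
evaluated on arbitrary smooth sections; it rests on `mvfderiv_mlieBracket`. From it follow `bianchi`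
and `oneFormCov_endCov_sub`. Finally `exists_parallel_orthonormal_frame` provides frames parallel to
first order at the point, in which `sq_mvfderiv_norm_le` gives differentiability of the norm and the
Cauchy–Schwarz bound. -/

theorem sum_bilin_orthonormalBasis_eq {T G ι κ : Type*} [NormedAddCommGroup T]
    [InnerProductSpace ℝ T] [FiniteDimensional ℝ T] [AddCommGroup G] [Module ℝ G] [Fintype ι]
    [Fintype κ] (B : T →ₗ[ℝ] T →ₗ[ℝ] G) (b : OrthonormalBasis ι ℝ T) (c : OrthonormalBasis κ ℝ T) :
    ∑ i, B (b i) (b i) = ∑ k, B (c k) (c k) := by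
  -- Both sums are the image under the lift of `B` of the canonical tensor `∑ b i ⊗ b i`, which is
  -- the same for every orthonormal basis.
  have h := congrArg (TensorProduct.lift B)
    ((InnerProductSpace.canonicalCovariantTensor_eq_sum T b).symm.trans
      (InnerProductSpace.canonicalCovariantTensor_eq_sum T c))
  simpa using h

theorem sum_norm_sq_orthonormalBasis_eq {T W ι κ : Type*} [NormedAddCommGroup T]
    [InnerProductSpace ℝ T] [FiniteDimensional ℝ T] [NormedAddCommGroup W] [InnerProductSpace ℝ W]
    [Fintype ι] [Fintype κ] (L : T →ₗ[ℝ] W) (b : OrthonormalBasis ι ℝ T)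
    (c : OrthonormalBasis κ ℝ T) :
    ∑ i, ‖L (b i)‖ ^ 2 = ∑ k, ‖L (c k)‖ ^ 2 := by
  have h := sum_bilin_orthonormalBasis_eq ((innerₗ W).compl₁₂ L L) b c
  simpa using h

/-- Complete the normalised Riesz representative of `ξ` to an orthonormal basis, placing it at `i₀`;
if `ξ = 0` any basis works. -/
theorem exists_orthonormalBasis_covector_eq_zero {T : Type*} [NormedAddCommGroup T]
    [InnerProductSpace ℝ T] [FiniteDimensional ℝ T] {n : ℕ} (hn : Module.finrank ℝ T = n)
    (i₀ : Fin n) (ξ : T →L[ℝ] ℝ) :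
    ∃ b : OrthonormalBasis (Fin n) ℝ T, ∀ i ≠ i₀, ξ (b i) = 0 := by
  set u := (InnerProductSpace.toDual ℝ T).symm ξ with hu
  have hξ (v : T) : ξ v = inner ℝ u v := by simp [hu]
  rcases eq_or_ne u 0 with h0 | h0
  · refine ⟨(stdOrthonormalBasis ℝ T).reindex (finCongr hn), fun i _ ↦ by simp [hξ, h0]⟩
  · have hv : Orthonormal ℝ (({i₀} : Set (Fin n)).domRestrict fun _ ↦ (‖u‖⁻¹ • u)) := by
      have : Subsingleton ({i₀} : Set (Fin n)) := inferInstance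
      refine ⟨fun i ↦ ?_, fun i j hij ↦ absurd (Subsingleton.elim i j) hij⟩
      change ‖‖u‖⁻¹ • u‖ = 1
      simp [norm_smul, h0]
    obtain ⟨b, hb⟩ := hv.exists_orthonormalBasis_extension_of_card_eq (by simp [hn])
    refine ⟨b, fun i hi ↦ ?_⟩
    have hb₀ := hb i₀ rfl
    have : u = ‖u‖ • b i₀ := by
      rw [hb₀, smul_smul, mul_inv_cancel₀ (norm_ne_zero_iff.2 h0), one_smul]
    rw [hξ, this, real_inner_smul_left, b.orthonormal.2 hi.symm, mul_zero]

theorem sq_sum_inner_le {W ι : Type*} [NormedAddCommGroup W] [InnerProductSpace ℝ W] [Fintype ι]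
    (x y : ι → W) : (∑ i, inner ℝ (x i) (y i)) ^ 2 ≤ (∑ i, ‖x i‖ ^ 2) * ∑ i, ‖y i‖ ^ 2 := by
  refine le_trans ?_ (Finset.sum_mul_sq_le_sq_mul_sq Finset.univ (fun i ↦ ‖x i‖) fun i ↦ ‖y i‖)
  rw [← sq_abs]
  refine pow_le_pow_left₀ (abs_nonneg _) ?_ 2
  exact (Finset.abs_sum_le_sum_abs _ _).trans
    (Finset.sum_le_sum fun i _ ↦ abs_real_inner_le_norm _ _)

variable {W : Type*} [NormedAddCommGroup W] {ι : Type*}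

theorem norm_sum_sq_le_card_mul (s : Finset ι) (v : ι → W) :
    ‖∑ i ∈ s, v i‖ ^ 2 ≤ s.card * ∑ i ∈ s, ‖v i‖ ^ 2 :=
  (pow_le_pow_left₀ (norm_nonneg _) (norm_sum_le _ _) 2).trans sq_sum_le_card_mul_sum_sq

/-- Young's inequality with weight `c * a`, the choice for which `a * ‖j‖ ^ 2` and `q` end up with
the same coefficient. In the applications `c` is the number of terms summed in `v`. -/
theorem norm_sub_sq_le_weighted {a c : ℝ} (ha : 0 < a) (hc : 0 ≤ c) {q : ℝ} (j v : W)
    (hv : ‖v‖ ^ 2 ≤ c * q) (hq : 0 ≤ q) :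
    a * ‖j - v‖ ^ 2 ≤ (1 + c * a) * (a * ‖j‖ ^ 2 + q) := by
  have h₁ : ‖j - v‖ ^ 2 ≤ (‖j‖ + ‖v‖) ^ 2 :=
    pow_le_pow_left₀ (norm_nonneg _) (norm_sub_le j v) 2
  -- The weight degenerates at `c = 0`, but then `v = 0`. This is the case of two-forms in dimension
  -- two.
  rcases hc.eq_or_lt with rfl | hc
  · have : ‖v‖ = 0 := by nlinarith [norm_nonneg v]
    rw [this] at h₁
    nlinarith
  have h₂ : 2 * ‖j‖ * ‖v‖ ≤ c * a * ‖j‖ ^ 2 + (c * a)⁻¹ * ‖v‖ ^ 2 := by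
    have hca : 0 < c * a := by positivity
    have := mul_nonneg (inv_nonneg.2 hca.le) (sq_nonneg (c * a * ‖j‖ - ‖v‖))
    have e : (c * a)⁻¹ * (c * a * ‖j‖ - ‖v‖) ^ 2 =
      c * a * ‖j‖ ^ 2 + (c * a)⁻¹ * ‖v‖ ^ 2 - 2 * ‖j‖ * ‖v‖ := by field_simp; ring
    linarith
  have h₃ : (1 + (c * a)⁻¹) * ‖v‖ ^ 2 ≤ (1 + (c * a)⁻¹) * (c * q) := by gcongr
  have h₄ : a * ((1 + (c * a)⁻¹) * (c * q)) = (1 + c * a) * q := by field_simp; ring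
  calc a * ‖j - v‖ ^ 2 ≤ a * ((1 + c * a) * ‖j‖ ^ 2 + (1 + (c * a)⁻¹) * (c * q)) := by
        gcongr; nlinarith
    _ = (1 + c * a) * (a * ‖j‖ ^ 2 + q) := by rw [mul_add, h₄]; ring

variable [Fintype ι] [DecidableEq ι]

/-- Row `i` and column `i` have equal entries and meet only in the vanishing entry `(i, i)`, so the
full sum contains the row twice. -/
theorem two_mul_sum_le_sum_sum {s : Finset ι} {f : ι → ι → ℝ} (hf : ∀ j k, 0 ≤ f j k)
    (hsymm : ∀ j k, f j k = f k j) {i : ι} (hi : i ∈ s) (hii : f i i = 0) :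
    2 * ∑ k ∈ s, f i k ≤ ∑ j ∈ s, ∑ k ∈ s, f j k := by
  rw [← Finset.add_sum_erase s (fun j ↦ ∑ k ∈ s, f j k) hi, two_mul]
  gcongr
  calc ∑ k ∈ s, f i k = ∑ k ∈ s.erase i, f k i := by
        rw [← Finset.add_sum_erase _ _ hi, hii, zero_add]
        exact Finset.sum_congr rfl fun k _ ↦ hsymm _ _
    _ ≤ _ := Finset.sum_le_sum fun k _ ↦
        Finset.single_le_sum (f := fun l ↦ f k l) (fun l _ ↦ hf k l) hi

/-- Here `N i j k` stands for `∇_i F_{jk}` applied to one fixed vector of the fibre, and `J` for the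
divergence. The entries of `N i₀` with an index `i₀` are estimated by `hJ`, the others by
`hbianchi`; for `i ≠ i₀` the first estimate spends the entries of `N i` without index `i₀`, the
second those with it. -/
theorem kato_twoForm_of_array (N : ι → ι → ι → W) (J : ι → W)
    (hanti : ∀ i j k, N i j k = - N i k j) (hdiag : ∀ i j, N i j j = 0)
    (hbianchi : ∀ i j k, N i j k + N j k i + N k i j = 0) (hJ : ∀ k, J k = ∑ i, N i i k)
    {a : ℝ} (ha : 0 < a) (hn : 2 ≤ Fintype.card ι) (i₀ : ι) :
    (1 + min (1 / 2) (a / (1 + ((Fintype.card ι : ℝ) - 2) * a))) *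
        (2⁻¹ * ∑ j, ∑ k, ‖N i₀ j k‖ ^ 2) ≤
      ∑ i, 2⁻¹ * ∑ j, ∑ k, ‖N i j k‖ ^ 2 + a * ∑ k, ‖J k‖ ^ 2 := by
  set S := (Finset.univ : Finset ι).erase i₀ with hS
  have hnS (i j k : ι) : ‖N i j k‖ ^ 2 = ‖N i k j‖ ^ 2 := by rw [hanti, norm_neg]
  have hn' : (0 : ℝ) ≤ (Fintype.card ι : ℝ) - 2 := by
    rw [sub_nonneg]; exact_mod_cast hn
  set m := (Fintype.card ι : ℝ) - 2 with hm
  set c := min (1 / 2) (a / (1 + m * a)) with hc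
  have hm1 : 0 < 1 + m * a := by positivity
  have split (f : ι → ℝ) : ∑ i, f i = f i₀ + ∑ i ∈ S, f i :=
    (Finset.add_sum_erase _ f (Finset.mem_univ i₀)).symm
  -- Pairs containing `i₀` occur in two orders, which absorbs the factor `2⁻¹`; the other pairs keep
  -- it.
  have form (i : ι) : 2⁻¹ * ∑ j, ∑ k, ‖N i j k‖ ^ 2 =
      ∑ k ∈ S, ‖N i i₀ k‖ ^ 2 + 2⁻¹ * ∑ j ∈ S, ∑ k ∈ S, ‖N i j k‖ ^ 2 := by
    rw [split, split, hdiag]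
    simp_rw [split, Finset.sum_add_distrib, fun j ↦ hnS i j i₀]
    simp; ring
  have inner_le (i : ι) (hi : i ∈ S) :
      ∑ k ∈ S, ‖N i i k‖ ^ 2 ≤ 2⁻¹ * ∑ j ∈ S, ∑ k ∈ S, ‖N i j k‖ ^ 2 := by
    have := two_mul_sum_le_sum_sum (s := S) (f := fun j k ↦ ‖N i j k‖ ^ 2)
      (fun _ _ ↦ by positivity) (fun j k ↦ hnS i j k) hi (by simp [hdiag])
    linarith
  -- The factor 2, hence the constant `1 / 2`, comes from `‖u - w‖² ≤ 2 (‖u‖² + ‖w‖²)` applied to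
  -- the Bianchi identity; the two squares have the same double sum.
  have tangential : 2⁻¹ * ∑ j ∈ S, ∑ k ∈ S, ‖N i₀ j k‖ ^ 2 ≤
      2 * ∑ j ∈ S, ∑ k ∈ S, ‖N j i₀ k‖ ^ 2 := by
    have h (j k : ι) : ‖N i₀ j k‖ ^ 2 ≤ 2 * (‖N j i₀ k‖ ^ 2 + ‖N k i₀ j‖ ^ 2) := by
      have e : N i₀ j k = N j i₀ k - N k i₀ j := by
        have := hbianchi i₀ j k
        rw [hanti j k i₀] at this
        rw [← sub_eq_zero, ← this]; abel
      rw [e]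
      have := norm_sub_le (N j i₀ k) (N k i₀ j)
      nlinarith [norm_nonneg (N j i₀ k - N k i₀ j), sq_nonneg (‖N j i₀ k‖ - ‖N k i₀ j‖)]
    have h' : ∑ j ∈ S, ∑ k ∈ S, ‖N i₀ j k‖ ^ 2 ≤
        ∑ j ∈ S, ∑ k ∈ S, 2 * (‖N j i₀ k‖ ^ 2 + ‖N k i₀ j‖ ^ 2) :=
      Finset.sum_le_sum fun j _ ↦ Finset.sum_le_sum fun k _ ↦ h j k
    have h'' : ∑ j ∈ S, ∑ k ∈ S, ‖N k i₀ j‖ ^ 2 = ∑ j ∈ S, ∑ k ∈ S, ‖N j i₀ k‖ ^ 2 :=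
      Finset.sum_comm
    simp_rw [← Finset.mul_sum, Finset.sum_add_distrib] at h'
    rw [h''] at h'
    linarith
  -- In the divergence the term `i = k` vanishes by `hdiag`, so apart from `i₀` only `m = n - 2`
  -- terms remain.
  have radial (k : ι) (hk : k ∈ S) :
      a / (1 + m * a) * ‖N i₀ i₀ k‖ ^ 2 ≤ a * ‖J k‖ ^ 2 + ∑ i ∈ S, ‖N i i k‖ ^ 2 := by
    have e : N i₀ i₀ k = J k - ∑ i ∈ S.erase k, N i i k := by
      rw [hJ, ← Finset.add_sum_erase _ _ (Finset.mem_univ i₀), ← hS,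
        ← Finset.add_sum_erase S _ hk, hdiag]
      abel
    have hcard : ((S.erase k).card : ℝ) = m := by
      rw [Finset.card_erase_of_mem hk, hS, Finset.card_erase_of_mem (Finset.mem_univ _),
        Finset.card_univ, hm, Nat.cast_sub (by omega), Nat.cast_sub (by omega)]
      push_cast; ring
    have h := norm_sum_sq_le_card_mul (S.erase k) fun i ↦ N i i k
    rw [hcard] at h
    have h₂ := norm_sub_sq_le_weighted ha hn' (J k) _ h (by positivity)
    rw [← e] at h₂
    have h₃ : ∑ i ∈ S.erase k, ‖N i i k‖ ^ 2 ≤ ∑ i ∈ S, ‖N i i k‖ ^ 2 :=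
      Finset.sum_le_sum_of_subset_of_nonneg (Finset.erase_subset _ _) fun _ _ _ ↦ by positivity
    rw [div_mul_eq_mul_div, div_le_iff₀ hm1]
    nlinarith
  have hradial : a / (1 + m * a) * ∑ k ∈ S, ‖N i₀ i₀ k‖ ^ 2 ≤
      a * ∑ k, ‖J k‖ ^ 2 + ∑ i ∈ S, 2⁻¹ * ∑ j ∈ S, ∑ k ∈ S, ‖N i j k‖ ^ 2 := by
    have h₁ := Finset.sum_le_sum radial
    rw [← Finset.mul_sum, Finset.sum_add_distrib, ← Finset.mul_sum, Finset.sum_comm] at h₁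
    have h₂ := Finset.sum_le_sum inner_le
    have h₃ : ∑ k ∈ S, ‖J k‖ ^ 2 ≤ ∑ k, ‖J k‖ ^ 2 :=
      Finset.sum_le_sum_of_subset_of_nonneg (Finset.erase_subset _ _) fun _ _ _ ↦ by positivity
    nlinarith
  have hc₁ : c ≤ 1 / 2 := min_le_left _ _
  have hc₂ : c ≤ a / (1 + m * a) := min_le_right _ _
  have p₁ : 0 ≤ ∑ k ∈ S, ‖N i₀ i₀ k‖ ^ 2 := by positivity
  have p₂ : 0 ≤ 2⁻¹ * ∑ j ∈ S, ∑ k ∈ S, ‖N i₀ j k‖ ^ 2 := by positivity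
  -- The available sum splits into the part spent by `tangential` and the part spent by `hradial`.
  have key : ∑ i ∈ S, 2⁻¹ * ∑ j, ∑ k, ‖N i j k‖ ^ 2 = ∑ i ∈ S, ∑ k ∈ S, ‖N i i₀ k‖ ^ 2 +
      ∑ i ∈ S, 2⁻¹ * ∑ j ∈ S, ∑ k ∈ S, ‖N i j k‖ ^ 2 := by
    rw [← Finset.sum_add_distrib]
    exact Finset.sum_congr rfl fun i _ ↦ form i
  rw [split fun i ↦ 2⁻¹ * ∑ j, ∑ k, ‖N i j k‖ ^ 2, key, form i₀]
  nlinarith [mul_le_mul_of_nonneg_right hc₂ p₁, mul_le_mul_of_nonneg_right hc₁ p₂]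

/-- Here `N i j` stands for `∇_i ∇_j Φ` on a fixed vector. The entry `N i₀ i₀` is minus the sum of
the other diagonal entries, and `N i₀ k` differs from `N k i₀` by `B i₀ k`. The first estimate uses
the diagonal, the second the column of `i₀`. -/
theorem kato_oneForm_of_array (N B : ι → ι → W) (hB : ∀ i j, B i j = N i j - N j i)
    (htrace : ∑ i, N i i = 0) {a : ℝ} (ha : 0 < a) (i₀ : ι) :
    (1 + if Fintype.card ι = 1 then a / (1 + a) else
        min (1 / ((Fintype.card ι : ℝ) - 1)) (a / (1 + a))) * ∑ j, ‖N i₀ j‖ ^ 2 ≤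
      ∑ i, ∑ j, ‖N i j‖ ^ 2 + a * (2⁻¹ * ∑ i, ∑ j, ‖B i j‖ ^ 2) := by
  set S := (Finset.univ : Finset ι).erase i₀ with hS
  have hcard : (S.card : ℝ) = (Fintype.card ι : ℝ) - 1 := by
    rw [hS, Finset.card_erase_of_mem (Finset.mem_univ _), Finset.card_univ,
      Nat.cast_sub (Fintype.card_pos_iff.2 ⟨i₀⟩)]
    simp
  set m := (Fintype.card ι : ℝ) - 1 with hm
  set c := if Fintype.card ι = 1 then a / (1 + a) else min (1 / m) (a / (1 + a)) with hc
  have split (f : ι → ℝ) : ∑ i, f i = f i₀ + ∑ i ∈ S, f i :=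
    (Finset.add_sum_erase _ f (Finset.mem_univ i₀)).symm
  have hBdiag : B i₀ i₀ = 0 := by simp [hB]
  have hBle : ∑ k ∈ S, ‖B i₀ k‖ ^ 2 ≤ 2⁻¹ * ∑ i, ∑ j, ‖B i j‖ ^ 2 := by
    have h := two_mul_sum_le_sum_sum (s := Finset.univ) (f := fun j k ↦ ‖B j k‖ ^ 2)
      (fun _ _ ↦ by positivity)
      (fun j k ↦ by simp only [hB j k, hB k j, norm_sub_rev]) (Finset.mem_univ i₀)
      (by simp [hBdiag])
    rw [split, hBdiag] at h
    simp only [norm_zero] at h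
    linarith
  have hNle : ∑ k ∈ S, ‖N k i₀‖ ^ 2 + ∑ k ∈ S, ‖N k k‖ ^ 2 ≤ ∑ i ∈ S, ∑ j, ‖N i j‖ ^ 2 := by
    rw [← Finset.sum_add_distrib]
    refine Finset.sum_le_sum fun k hk ↦ ?_
    rw [split]
    gcongr
    exact Finset.single_le_sum (f := fun l ↦ ‖N k l‖ ^ 2) (fun l _ ↦ by positivity) hk
  have hc₂ : c ≤ a / (1 + a) := by
    rw [hc]; split_ifs
    exacts [le_rfl, min_le_right _ _]
  have hradial : c * ‖N i₀ i₀‖ ^ 2 ≤ ∑ k ∈ S, ‖N k k‖ ^ 2 := by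
    have e : N i₀ i₀ = - ∑ k ∈ S, N k k := by
      rw [← Finset.add_sum_erase _ _ (Finset.mem_univ i₀)] at htrace
      exact eq_neg_of_add_eq_zero_left htrace
    have h := norm_sum_sq_le_card_mul S fun k ↦ N k k
    rw [← norm_neg, ← e, hcard] at h
    -- With a single index the trace condition forces `N i₀ i₀ = 0`, so the diagonal puts no
    -- constraint on the constant; this is the reading `1 / (n - 1) = +∞`.
    by_cases h1 : Fintype.card ι = 1
    · have hm0 : m = 0 := by simp [hm, h1]
      rw [hm0, zero_mul] at h
      have : ‖N i₀ i₀‖ ^ 2 = 0 := le_antisymm h (by positivity)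
      rw [this, mul_zero]
      positivity
    · have hm0 : 0 < m := by
        have : 0 < Fintype.card ι := Fintype.card_pos_iff.2 ⟨i₀⟩
        have : 2 ≤ Fintype.card ι := by omega
        have : (2 : ℝ) ≤ Fintype.card ι := by exact_mod_cast this
        linarith
      have hc₁ : c ≤ 1 / m := by
        rw [hc, if_neg h1]; exact min_le_left _ _
      calc c * ‖N i₀ i₀‖ ^ 2 ≤ 1 / m * (m * ∑ k ∈ S, ‖N k k‖ ^ 2) := by gcongr
        _ = _ := by field_simp
  have htangential : c * ∑ k ∈ S, ‖N i₀ k‖ ^ 2 ≤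
      ∑ k ∈ S, ‖N k i₀‖ ^ 2 + a * ∑ k ∈ S, ‖B i₀ k‖ ^ 2 := by
    refine (mul_le_mul_of_nonneg_right hc₂ (by positivity)).trans ?_
    rw [Finset.mul_sum, Finset.mul_sum, ← Finset.sum_add_distrib]
    refine Finset.sum_le_sum fun k _ ↦ ?_
    have e : N i₀ k = B i₀ k - - N k i₀ := by rw [hB]; abel
    -- Only one term is subtracted, so `c = 1` and the constant is `a / (1 + a)` in every dimension.
    have h := norm_sub_sq_le_weighted ha zero_le_one (q := ‖N k i₀‖ ^ 2) (B i₀ k) (- N k i₀)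
      (by simp) (by positivity)
    rw [← e] at h
    rw [div_mul_eq_mul_div, div_le_iff₀ (by positivity)]
    linarith
  rw [split fun i ↦ ∑ j, ‖N i j‖ ^ 2, split fun j ↦ ‖N i₀ j‖ ^ 2]
  nlinarith

end LinearAlgebra

/-! ### Global smooth representatives of germs of sections -/

section Extension

variable {E : Type*} [NormedAddCommGroup E] [NormedSpace ℝ E] [FiniteDimensional ℝ E]
  {H : Type*} [TopologicalSpace H] {I : ModelWithCorners ℝ E H}
  {M : Type*} [TopologicalSpace M] [ChartedSpace H M] [IsManifold I ∞ M] [T2Space M]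
  {F : Type*} [NormedAddCommGroup F] [NormedSpace ℝ F]
  {V : M → Type*} [TopologicalSpace (TotalSpace F V)]
  [∀ x, AddCommGroup (V x)] [∀ x, Module ℝ (V x)]
  [∀ x, TopologicalSpace (V x)]
  [FiberBundle F V] [VectorBundle ℝ F V]

/-- Multiply by a bump function supported in the interior of `U` and equal to one near `x`. Later
computations can then use globally smooth sections only. -/
theorem exists_contMDiff_eventuallyEq {x : M} {s : Π x, V x} {U : Set M} (hU : U ∈ 𝓝 x)
    (hs : CMDiff[U] ∞ (T% s)) :
    ∃ t : Π x, V x, CMDiff ∞ (T% t) ∧ ∀ᶠ y in 𝓝 x, t y = s y := by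
  obtain ⟨f, -, hf⟩ := (SmoothBumpFunction.nhds_basis_tsupport (I := I) x).mem_iff.1
    (interior_mem_nhds.2 hU)
  refine ⟨(f : M → ℝ) • s, fun y ↦ ?_, ?_⟩
  · by_cases hy : y ∈ tsupport f
    · exact (f.contMDiff y).smul_section (hs.contMDiffAt (mem_interior_iff_mem_nhds.1 (hf hy)))
    · refine (Bundle.contMDiff_zeroSection ℝ V y).congr_of_eventuallyEq ?_
      filter_upwards [(isClosed_tsupport f).isOpen_compl.mem_nhds hy] with z hz
      simp [image_eq_zero_of_notMem_tsupport hz]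
      rfl
  · filter_upwards [f.eventuallyEq_one] with y hy
    simp [hy]

theorem exists_contMDiff_real_eventuallyEq {x : M} {g : M → ℝ} {U : Set M} (hU : U ∈ 𝓝 x)
    (hg : CMDiff[U] ∞ g) : ∃ f : M → ℝ, CMDiff ∞ f ∧ ∀ᶠ y in 𝓝 x, f y = g y := by
  obtain ⟨f, -, hf⟩ := (SmoothBumpFunction.nhds_basis_tsupport (I := I) x).mem_iff.1
    (interior_mem_nhds.2 hU)
  refine ⟨fun y ↦ f y * g y, fun y ↦ ?_, ?_⟩
  · by_cases hy : y ∈ tsupport f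
    · exact (f.contMDiff y).mul (hg.contMDiffAt (mem_interior_iff_mem_nhds.1 (hf hy)))
    · refine (contMDiff_const (c := (0 : ℝ)) y).congr_of_eventuallyEq ?_
      filter_upwards [(isClosed_tsupport f).isOpen_compl.mem_nhds hy] with z hz
      simp [image_eq_zero_of_notMem_tsupport hz]
  · filter_upwards [f.eventuallyEq_one] with y hy
    simp [hy]

variable (I F) in
theorem exists_contMDiff_extend [ContMDiffVectorBundle ∞ F V I] {x : M} (v : V x) :
    ∃ t : Π x, V x, CMDiff ∞ (T% t) ∧ (∀ᶠ y in 𝓝 x, t y = extend F v y) ∧ t x = v := by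
  obtain ⟨U, hU, hs⟩ := exists_contMDiffOn_extend (k := ∞) I F v
  obtain ⟨t, ht, h⟩ := exists_contMDiff_eventuallyEq hU hs
  exact ⟨t, ht, h, by rw [h.self_of_nhds, extend_apply_self]⟩

/-- Frame and coefficients from a trivialisation, both cut off to be global. The vanishing of the
coefficients wherever `s x = 0` is what turns linearity over functions into pointwise dependence. -/
theorem exists_contMDiff_local_frame [FiniteDimensional ℝ F] [ContMDiffVectorBundle ∞ F V I]
    {s : Π x, V x} (hs : CMDiff ∞ (T% s)) (x : M) :
    ∃ (c : Fin (Module.finrank ℝ F) → M → ℝ) (t : Fin (Module.finrank ℝ F) → Π x, V x),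
      (∀ i, CMDiff ∞ (c i)) ∧ (∀ i, CMDiff ∞ (T% (t i))) ∧
      (∀ᶠ y in 𝓝 x, s y = ∑ i, c i y • t i y) ∧ (s x = 0 → ∀ i, c i x = 0) := by
  have : ContMDiffVectorBundle 1 F V I := ContMDiffVectorBundle.of_le (n := ∞) (by simp)
  set e := trivializationAt F V x
  have hx : x ∈ e.baseSet := mem_baseSet_trivializationAt' x
  have he := e.open_baseSet.mem_nhds hx
  let b := Module.finBasis ℝ F
  choose t ht hte using fun i ↦ exists_contMDiff_eventuallyEq he
    (e.contMDiffOn_localFrame_baseSet (I := I) ∞ b i)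
  choose c hc hce using fun i ↦ exists_contMDiff_real_eventuallyEq he
    (contMDiffOn_baseSet_localFrameCoeff (I := I) (e := e) b hs.contMDiffOn i)
  refine ⟨c, t, hc, ht, ?_, fun h i ↦ ?_⟩
  swap
  · rw [(hce i).self_of_nhds]
    simp [h]
  filter_upwards [Filter.eventually_all.2 hte, Filter.eventually_all.2 hce,
    e.eventually_eq_localFrame_sum_coeff_smul (I := I) b (s := s) hx] with y h₁ h₂ h₃
  rw [h₃]
  exact Finset.sum_congr rfl fun i _ ↦ by rw [h₁, h₂]; rfl

end Extension

/-! ### The Lie bracket as a commutator of derivations -/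

section Commutator

variable {E : Type*} [NormedAddCommGroup E] [NormedSpace ℝ E] [FiniteDimensional ℝ E]
  {H : Type*} [TopologicalSpace H] {I : ModelWithCorners ℝ E H}
  {M : Type*} [TopologicalSpace M] [ChartedSpace H M] [IsManifold I ∞ M]
  {X Y : Π x : M, TangentSpace I x} {f : M → ℝ}

theorem contMDiff_mvfderiv_apply (hf : CMDiff ∞ f) (hX : CMDiff ∞ (T% X)) :
    CMDiff ∞ (fun y ↦ mvfderiv I f y (X y)) := by
  have h := (hf.contMDiff_tangentMap (m := ∞) (by simp)).comp hX
  exact (contMDiff_snd_tangentBundle_modelSpace ℝ 𝓘(ℝ, ℝ)).comp h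

theorem contMDiff_mlieBracket (hX : CMDiff ∞ (T% X)) (hY : CMDiff ∞ (T% Y)) :
    CMDiff ∞ (T% (VectorField.mlieBracket I X Y)) := by
  have : IsManifold I (minSmoothness ℝ 2) M := by
    rw [minSmoothness_of_isRCLikeNormedField]; infer_instance
  have : IsManifold I (minSmoothness ℝ 3) M := by
    rw [minSmoothness_of_isRCLikeNormedField]; exact IsManifold.of_le (n := ∞) ENat.LEInfty.out
  have : IsManifold I (((⊤ : ℕ∞) : ℕ∞ω) + 1) M := by simpa
  exact ContDiff.mlieBracket_vectorField (m := ⊤) (n := ⊤) hX hY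
    (by rw [minSmoothness_of_isRCLikeNormedField]; simp)

/-- Insert `f • Z` with `Z x ≠ 0` in the Jacobi identity for `X`, `Y` and expand by the Leibniz
rule. Subtracting `f x` times the identity for `Z` leaves the difference of the two sides multiplied
by `Z x`. If the tangent space is zero there is nothing to prove. -/
theorem mvfderiv_mlieBracket [T2Space M] (hf : CMDiff ∞ f) (hX : CMDiff ∞ (T% X))
    (hY : CMDiff ∞ (T% Y)) (x : M) :
    mvfderiv I f x (VectorField.mlieBracket I X Y x) =
      mvfderiv I (fun y ↦ mvfderiv I f y (Y y)) x (X x) -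
        mvfderiv I (fun y ↦ mvfderiv I f y (X y)) x (Y x) := by
  have hd {Z : Π x : M, TangentSpace I x} (hZ : CMDiff ∞ (T% Z)) (y : M) : MDiffAt (T% Z) y :=
    (hZ y).mdifferentiableAt (by simp)
  have hdf {g : M → ℝ} (hg : CMDiff ∞ g) (y : M) : MDiffAt g y :=
    (hg y).mdifferentiableAt (by simp)
  by_cases hz : ∃ z : TangentSpace I x, z ≠ 0
  swap
  · push Not at hz
    simp [hz (X x), hz (Y x), hz (VectorField.mlieBracket I X Y x)]
  obtain ⟨z, hz⟩ := hz
  obtain ⟨Z, hZ, -, hZx⟩ := exists_contMDiff_extend I E z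
  have h2 {Z : Π x : M, TangentSpace I x} (hZ : CMDiff ∞ (T% Z)) :
      CMDiffAt (minSmoothness ℝ 2) (T% Z) x := by
    rw [minSmoothness_of_isRCLikeNormedField]
    exact (hZ x).of_le ENat.LEInfty.out
  have hfZ : CMDiff ∞ (T% (f • Z)) := hf.smul_section hZ
  have expand {Y : Π x : M, TangentSpace I x} :
      VectorField.mlieBracket I Y (f • Z) =
        (fun y ↦ mvfderiv I f y (Y y)) • Z + f • VectorField.mlieBracket I Y Z := by
    ext1 y
    exact VectorField.mlieBracket_smul_right (hdf hf y) (hd hZ y)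
  have expand₂ {X Y : Π x : M, TangentSpace I x} (hX : CMDiff ∞ (T% X)) (hY : CMDiff ∞ (T% Y)) :
      VectorField.mlieBracket I X (VectorField.mlieBracket I Y (f • Z)) x =
        mvfderiv I (fun y ↦ mvfderiv I f y (Y y)) x (X x) • Z x +
          mvfderiv I f x (Y x) • VectorField.mlieBracket I X Z x +
          (mvfderiv I f x (X x) • VectorField.mlieBracket I Y Z x +
            f x • VectorField.mlieBracket I X (VectorField.mlieBracket I Y Z) x) := by
    have hYf := contMDiff_mvfderiv_apply hf hY
    have hYZ := contMDiff_mlieBracket hY hZ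
    rw [expand, VectorField.mlieBracket_add_right (hd (hYf.smul_section hZ) x)
      (hd (hf.smul_section hYZ) x),
      VectorField.mlieBracket_smul_right (hdf hYf x) (hd hZ x),
      VectorField.mlieBracket_smul_right (hdf hf x) (hd hYZ x)]
  have : IsManifold I (minSmoothness ℝ 3) M := by
    rw [minSmoothness_of_isRCLikeNormedField]; exact IsManifold.of_le (n := ∞) ENat.LEInfty.out
  have J := VectorField.leibniz_identity_mlieBracket_apply (h2 hX) (h2 hY) (h2 hfZ)
  have J₀ := VectorField.leibniz_identity_mlieBracket_apply (h2 hX) (h2 hY) (h2 hZ)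
  rw [expand₂ hX hY, expand₂ hY hX, expand] at J
  simp only [Pi.add_apply, Pi.smul_apply', J₀] at J
  have : (mvfderiv I (fun y ↦ mvfderiv I f y (Y y)) x (X x) -
      mvfderiv I (fun y ↦ mvfderiv I f y (X y)) x (Y x) -
      mvfderiv I f x (VectorField.mlieBracket I X Y x)) • Z x = 0 := by
    rw [← sub_eq_zero] at J
    rw [← J]
    module
  rw [hZx] at this
  have := (smul_eq_zero.1 this).resolve_right hz
  linarith

end Commutator

/-! ### Tensoriality of the curvature in the section -/

section CurvatureTensor

variable {E : Type*} [NormedAddCommGroup E] [NormedSpace ℝ E] [FiniteDimensional ℝ E]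
  {H : Type*} [TopologicalSpace H] {I : ModelWithCorners ℝ E H}
  {M : Type*} [TopologicalSpace M] [ChartedSpace H M] [IsManifold I ∞ M] [T2Space M]
  {F : Type*} [NormedAddCommGroup F] [NormedSpace ℝ F]
  {V : M → Type*} [TopologicalSpace (TotalSpace F V)]
  [∀ x, NormedAddCommGroup (V x)] [∀ x, InnerProductSpace ℝ (V x)]
  [FiberBundle F V] [VectorBundle ℝ F V]
  (cov : CovariantDerivative I F V) [hcov : cov.ContMDiffCovariantDerivative ∞]
  {X Y : Π x : M, TangentSpace I x} {s t : Π x, V x}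

theorem contMDiff_cov (hs : CMDiff ∞ (T% s)) :
    ContMDiff I (I.prod 𝓘(ℝ, E →L[ℝ] F)) ∞
      (fun y ↦ (⟨y, cov s y⟩ : TotalSpace (E →L[ℝ] F) fun y ↦ TangentSpace I y →L[ℝ] V y)) :=
  contMDiffOn_univ.1 (hcov.contMDiff.contMDiff (σ := s) (by simpa using hs.contMDiffOn))

theorem contMDiff_cov_apply (hX : CMDiff ∞ (T% X)) (hs : CMDiff ∞ (T% s)) :
    CMDiff ∞ (T% (fun y ↦ cov s y (X y))) :=
  (contMDiff_cov cov hs).clm_bundle_apply (F₁ := E) (F₂ := F) hX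

/-- The first-order cross terms are symmetric in `X` and `Y` and cancel; the second derivatives of
`f` form `X(Yf) - Y(Xf)`, which the bracket term removes by `mvfderiv_mlieBracket`. -/
theorem curvatureAux_mul {f : M → ℝ} (hf : CMDiff ∞ f) (hs : CMDiff ∞ (T% s))
    (hX : CMDiff ∞ (T% X)) (hY : CMDiff ∞ (T% Y)) (x : M) :
    curvatureAux cov X Y (f • s) x = f x • curvatureAux cov X Y s x := by
  have hd {s : Π x, V x} (hs : CMDiff ∞ (T% s)) (y : M) : MDiffAt (T% s) y :=
    (hs y).mdifferentiableAt (by simp)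
  have hdf {g : M → ℝ} (hg : CMDiff ∞ g) (y : M) : MDiffAt g y :=
    (hg y).mdifferentiableAt (by simp)
  have expand {Y : Π x : M, TangentSpace I x} : (fun y ↦ cov (f • s) y (Y y)) =
      f • (fun y ↦ cov s y (Y y)) + (fun y ↦ mvfderiv I f y (Y y)) • s := by
    ext1 y
    rw [cov.isCovariantDerivativeOn.leibniz (hd hs y) (hdf hf y) (s := univ)]
    simp
  have expand₂ {X Y : Π x : M, TangentSpace I x} (hY : CMDiff ∞ (T% Y)) :
      cov (fun y ↦ cov (f • s) y (Y y)) x (X x) =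
        f x • cov (fun y ↦ cov s y (Y y)) x (X x) + mvfderiv I f x (X x) • cov s x (Y x) +
        (mvfderiv I f x (Y x) • cov s x (X x) +
          mvfderiv I (fun y ↦ mvfderiv I f y (Y y)) x (X x) • s x) := by
    have h₁ := contMDiff_cov_apply cov hY hs
    have h₂ := contMDiff_mvfderiv_apply hf hY
    rw [expand, cov.isCovariantDerivativeOn.add (hd (hf.smul_section h₁) x)
      (hd (h₂.smul_section hs) x) (s := univ),
      cov.isCovariantDerivativeOn.leibniz (hd h₁ x) (hdf hf x) (s := univ),
      cov.isCovariantDerivativeOn.leibniz (hd hs x) (hdf h₂ x) (s := univ)]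
    simp
  rw [curvatureAux, expand₂ hY, expand₂ hX,
    cov.isCovariantDerivativeOn.leibniz (hd hs x) (hdf hf x) (s := univ), curvatureAux]
  simp only [add_apply, smul_apply, ContinuousLinearMap.smulRight_apply,
    mvfderiv_mlieBracket hf hX hY]
  module

theorem curvatureAux_sum {ι : Type*} (S : Finset ι) {t : ι → Π x, V x}
    (ht : ∀ i, CMDiff ∞ (T% (t i))) (hX : CMDiff ∞ (T% X)) (hY : CMDiff ∞ (T% Y)) (x : M) :
    curvatureAux cov X Y (fun y ↦ ∑ i ∈ S, t i y) x = ∑ i ∈ S, curvatureAux cov X Y (t i) x := by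
  classical
  have hdX : MDiffAt (T% X) x := (hX x).mdifferentiableAt (by simp)
  have hdY : MDiffAt (T% Y) x := (hY x).mdifferentiableAt (by simp)
  induction S using Finset.induction_on with
  | empty =>
    have h := curvatureAux_smul cov (U := univ) Filter.univ_mem 0 (s := 0)
      (Bundle.contMDiff_zeroSection ℝ V).contMDiffOn hdX hdY
    rw [zero_smul, zero_smul] at h
    simpa using! h
  | insert i S hi ih =>
    simp only [Finset.sum_insert hi]
    rw [← ih]
    exact curvatureAux_add cov (U := univ) Filter.univ_mem (ht i).contMDiffOn
      (ContMDiff.sum_section fun j _ ↦ ht j).contMDiffOn hdX hdY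

variable [FiniteDimensional ℝ F] [ContMDiffVectorBundle ∞ F V I]

theorem curvatureAux_congr_germ (hs : CMDiff ∞ (T% s)) (ht : CMDiff ∞ (T% t)) {x : M}
    (h : ∀ᶠ y in 𝓝 x, s y = t y) (hX : MDiffAt (T% X) x) (hY : MDiffAt (T% Y) x) :
    curvatureAux cov X Y s x = curvatureAux cov X Y t x := by
  obtain ⟨U, hU, h⟩ := h.exists_mem
  exact curvatureAux_congr cov hU hs.contMDiffOn ht.contMDiffOn h hX hY

/-- Near `x` the section is `∑ c i • t i` with `c i x = 0`, and the functions `c i` come out of the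
curvature. -/
theorem curvatureAux_eq_zero (hs : CMDiff ∞ (T% s)) (hX : CMDiff ∞ (T% X))
    (hY : CMDiff ∞ (T% Y)) {x : M} (hx : s x = 0) : curvatureAux cov X Y s x = 0 := by
  obtain ⟨c, t, hc, ht, h, h0⟩ := exists_contMDiff_local_frame hs x
  have hct (i) : CMDiff ∞ (T% (c i • t i)) := (hc i).smul_section (ht i)
  rw [curvatureAux_congr_germ cov hs (t := fun y ↦ ∑ i, (c i • t i) y)
    (ContMDiff.sum_section fun j _ ↦ hct j) h
    ((hX x).mdifferentiableAt (by simp)) ((hY x).mdifferentiableAt (by simp)),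
    curvatureAux_sum cov Finset.univ hct hX hY]
  exact Finset.sum_eq_zero fun i _ ↦ by
    rw [curvatureAux_mul cov (hc i) (ht i) hX hY, h0 hx i, zero_smul]

/-- The definition of `curvature` uses one particular extension of each vector. Here it becomes
computable on any smooth data: two sections with the same value at `x` differ by one vanishing
there. -/
theorem curvature_apply_of_contMDiff (hs : CMDiff ∞ (T% s)) (hX : CMDiff ∞ (T% X))
    (hY : CMDiff ∞ (T% Y)) (x : M) :
    curvature cov x (X x) (Y x) (s x) = curvatureAux cov X Y s x := by
  have hdX : MDiffAt (T% X) x := (hX x).mdifferentiableAt (by simp)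
  have hdY : MDiffAt (T% Y) x := (hY x).mdifferentiableAt (by simp)
  have h₁ : curvature cov x (X x) (Y x) (s x) = curvatureAux cov X Y (extend F (s x)) x :=
    TensorialAt.mkHom₂_apply (Φ := (curvatureAux cov · · (extend F (s x)) x))
      (fun _ _ ↦ curvatureAux_tensorial₁ cov (mdifferentiableAt_cov_extend cov (s x)))
      (fun _ _ ↦ curvatureAux_tensorial₂ cov (mdifferentiableAt_cov_extend cov (s x))) hdX hdY
  obtain ⟨U, hU, hext⟩ := exists_contMDiffOn_extend (k := ∞) I F (s x)
  -- `extend F (s x)` is known to be smooth only near `x`, so it is replaced by a global section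
  -- with the same germ before being compared with `s`.
  obtain ⟨t, ht, hte, htx⟩ := exists_contMDiff_extend I F (s x)
  obtain ⟨U', hU', h'⟩ := hte.exists_mem
  have h₂ : curvatureAux cov X Y t x = curvatureAux cov X Y (extend F (s x)) x :=
    curvatureAux_congr cov (Filter.inter_mem hU hU') ht.contMDiffOn
      (hext.mono inter_subset_left) (fun y hy ↦ h' y hy.2) hdX hdY
  have hns : CMDiff ∞ (T% ((-1 : ℝ) • t)) := ht.const_smul_section
  have h₃ := curvatureAux_eq_zero cov (s := s + (-1 : ℝ) • t) (hs.add_section hns) hX hY (x := x)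
    (by simp [htx])
  rw [curvatureAux_add cov (U := univ) Filter.univ_mem hs.contMDiffOn hns.contMDiffOn hdX hdY,
    curvatureAux_smul cov (U := univ) Filter.univ_mem _ ht.contMDiffOn hdX hdY] at h₃
  rw [h₁, ← h₂]
  rw [neg_one_smul, ← sub_eq_add_neg, sub_eq_zero] at h₃
  exact h₃.symm

end CurvatureTensor

/-! ### Differentiability of bundle maps, tested on sections -/

section HomSections

variable {E : Type*} [NormedAddCommGroup E] [NormedSpace ℝ E]
  {H : Type*} [TopologicalSpace H] {I : ModelWithCorners ℝ E H}
  {M : Type*} [TopologicalSpace M] [ChartedSpace H M] [IsManifold I ∞ M]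
  {F : Type*} [NormedAddCommGroup F] [NormedSpace ℝ F] [FiniteDimensional ℝ F]
  {V : M → Type*} [TopologicalSpace (TotalSpace F V)]
  [∀ x, AddCommGroup (V x)] [∀ x, Module ℝ (V x)]
  [∀ x, TopologicalSpace (V x)]
  [∀ x, IsTopologicalAddGroup (V x)] [∀ x, ContinuousSMul ℝ (V x)]
  [FiberBundle F V] [VectorBundle ℝ F V]
  {G : Type*} [NormedAddCommGroup G] [NormedSpace ℝ G]
  {W : M → Type*} [TopologicalSpace (TotalSpace G W)]
  [∀ x, AddCommGroup (W x)] [∀ x, Module ℝ (W x)]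
  [∀ x, TopologicalSpace (W x)]
  [∀ x, IsTopologicalAddGroup (W x)] [∀ x, ContinuousSMul ℝ (W x)]
  [FiberBundle G W] [VectorBundle ℝ G W]

theorem mdifferentiableAt_clm_of_basis {Λ : M → F →L[ℝ] G} {x : M}
    (h : ∀ f : F, MDiffAt (fun y ↦ Λ y f) x) : MDiffAt Λ x := by
  let b := Module.finBasis ℝ F
  let T (i) : G →L[ℝ] (F →L[ℝ] G) :=
    ContinuousLinearMap.smulRightL ℝ F G (LinearMap.toContinuousLinearMap (b.coord i))
  have hΛ : Λ = ∑ i, fun y ↦ T i (Λ y (b i)) := by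
    ext y f
    simp only [T, Finset.sum_apply, sum_apply]
    conv_lhs => rw [← b.sum_repr f]
    simp only [map_sum, map_smul]
    rfl
  rw [hΛ]
  exact MDifferentiableAt.sum fun i _ ↦ (T i).mdifferentiableAt.comp x (h (b i))

/-- In the trivialisation at `x`, `extend F v` has constant coordinates, so the hypothesis says that
the coordinate matrix of `A` is differentiable on each constant vector; in finite rank this
suffices. -/
theorem mdifferentiableAt_hom_of_extend {A : Π y, V y →L[ℝ] W y} {x : M}
    (h : ∀ v : V x, MDiffAt (T% (fun y ↦ A y (extend F v y))) x) :
    MDifferentiableAt I (I.prod 𝓘(ℝ, F →L[ℝ] G))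
      (fun y ↦ TotalSpace.mk' (F →L[ℝ] G) y (A y)) x := by
  rw [mdifferentiableAt_hom_bundle]
  refine ⟨mdifferentiableAt_id, mdifferentiableAt_clm_of_basis fun f ↦ ?_⟩
  have hx : x ∈ (trivializationAt F V x).baseSet := mem_baseSet_trivializationAt' x
  have hx' : x ∈ (trivializationAt G W x).baseSet := mem_baseSet_trivializationAt' x
  have h₁ := (mdifferentiableAt_totalSpace I (F := G) (E := W) _).1
    (h ((trivializationAt F V x).symm x f)) |>.2
  refine h₁.congr_of_eventuallyEq ?_
  filter_upwards [(trivializationAt F V x).open_baseSet.mem_nhds hx,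
    (trivializationAt G W x).open_baseSet.mem_nhds hx'] with y hy hy'
  have : extend F ((trivializationAt F V x).symm x f) y = (trivializationAt F V x).symm y f := by
    rw [extend, (trivializationAt F V x).apply_mk_symm hx]
  simp [ContinuousLinearMap.inCoordinates, this, hy', Trivialization.symmL_apply _ hy]

end HomSections

/-! ### The curvature and `dΦ` as differentiable tensors -/

section DifferentiableTensors

variable {E : Type*} [NormedAddCommGroup E] [NormedSpace ℝ E] [FiniteDimensional ℝ E]
  {H : Type*} [TopologicalSpace H] {I : ModelWithCorners ℝ E H}
  {M : Type*} [TopologicalSpace M] [ChartedSpace H M] [IsManifold I ∞ M] [T2Space M]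
  {F : Type*} [NormedAddCommGroup F] [NormedSpace ℝ F] [FiniteDimensional ℝ F]
  {V : M → Type*} [TopologicalSpace (TotalSpace F V)]
  [∀ x, NormedAddCommGroup (V x)] [∀ x, InnerProductSpace ℝ (V x)]
  [FiberBundle F V] [VectorBundle ℝ F V] [ContMDiffVectorBundle ∞ F V I]

/-- The induced connection `homCov` is set to zero at points where its argument is not
differentiable, so its product rule can be used only once differentiability as a tensor is known. -/
theorem mdifferentiableAt_oneForm {α : Π x : M, TangentSpace I x →L[ℝ] V x →L[ℝ] V x}
    (h : ∀ (X : Π x : M, TangentSpace I x) (s : Π x, V x), CMDiff ∞ (T% X) → CMDiff ∞ (T% s) →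
      CMDiff ∞ (T% (fun y ↦ α y (X y) (s y)))) (x : M) :
    MDifferentiableAt I (I.prod 𝓘(ℝ, E →L[ℝ] F →L[ℝ] F))
      (fun y ↦ TotalSpace.mk' (E →L[ℝ] F →L[ℝ] F)
        (E := fun y : M ↦ TangentSpace I y →L[ℝ] V y →L[ℝ] V y) y (α y)) x := by
  refine mdifferentiableAt_hom_of_extend (W := fun y ↦ V y →L[ℝ] V y) fun v ↦
    mdifferentiableAt_hom_of_extend (W := V) fun w ↦ ?_
  obtain ⟨X, hX, hXe, -⟩ := exists_contMDiff_extend I E v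
  obtain ⟨s, hs, hse, -⟩ := exists_contMDiff_extend I F w
  refine ((h X s hX hs x).mdifferentiableAt (by simp)).congr_of_eventuallyEq ?_
  filter_upwards [hXe, hse] with y h₁ h₂
  rw [h₁, h₂]

theorem mdifferentiableAt_twoForm
    {η : Π x : M, TangentSpace I x →L[ℝ] TangentSpace I x →L[ℝ] V x →L[ℝ] V x}
    (h : ∀ (X Y : Π x : M, TangentSpace I x) (s : Π x, V x), CMDiff ∞ (T% X) → CMDiff ∞ (T% Y) →
      CMDiff ∞ (T% s) → CMDiff ∞ (T% (fun y ↦ η y (X y) (Y y) (s y)))) (x : M) :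
    MDifferentiableAt I (I.prod 𝓘(ℝ, E →L[ℝ] E →L[ℝ] F →L[ℝ] F))
      (fun y ↦ TotalSpace.mk' (E →L[ℝ] E →L[ℝ] F →L[ℝ] F)
        (E := fun y : M ↦ TangentSpace I y →L[ℝ] TangentSpace I y →L[ℝ] V y →L[ℝ] V y)
        y (η y)) x := by
  refine mdifferentiableAt_hom_of_extend
    (W := fun y ↦ TangentSpace I y →L[ℝ] V y →L[ℝ] V y) fun v ↦ ?_
  obtain ⟨X, hX, hXe, -⟩ := exists_contMDiff_extend I E v
  refine (mdifferentiableAt_oneForm (α := fun y ↦ η y (X y))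
    (fun Y s hY hs ↦ h X Y s hX hY hs) x).congr_of_eventuallyEq ?_
  filter_upwards [hXe] with y h₁
  rw [h₁]

theorem contMDiff_curvatureAux (A : CovariantDerivative I F V) [A.ContMDiffCovariantDerivative ∞]
    {X Y : Π x : M, TangentSpace I x} {s : Π x, V x} (hX : CMDiff ∞ (T% X))
    (hY : CMDiff ∞ (T% Y)) (hs : CMDiff ∞ (T% s)) :
    CMDiff ∞ (T% (fun y ↦ curvatureAux A X Y s y)) := by
  have h₁ := contMDiff_cov_apply A hX (contMDiff_cov_apply A hY hs)
  have h₂ := contMDiff_cov_apply A hY (contMDiff_cov_apply A hX hs)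
  have h₃ := contMDiff_cov_apply A (contMDiff_mlieBracket hX hY) hs
  exact (h₁.sub_section h₂).sub_section h₃

theorem contMDiff_curvature_apply (A : CovariantDerivative I F V)
    [A.ContMDiffCovariantDerivative ∞] {X Y : Π x : M, TangentSpace I x} {s : Π x, V x}
    (hX : CMDiff ∞ (T% X)) (hY : CMDiff ∞ (T% Y)) (hs : CMDiff ∞ (T% s)) :
    CMDiff ∞ (T% (fun y ↦ curvature A y (X y) (Y y) (s y))) := by
  simp_rw [fun y ↦ curvature_apply_of_contMDiff A hs hX hY y]
  exact contMDiff_curvatureAux A hX hY hs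

theorem mdifferentiableAt_curvature (A : CovariantDerivative I F V)
    [A.ContMDiffCovariantDerivative ∞] (x : M) :
    MDifferentiableAt I (I.prod 𝓘(ℝ, E →L[ℝ] E →L[ℝ] F →L[ℝ] F))
      (fun y ↦ TotalSpace.mk' (E →L[ℝ] E →L[ℝ] F →L[ℝ] F)
        (E := fun y : M ↦ TangentSpace I y →L[ℝ] TangentSpace I y →L[ℝ] V y →L[ℝ] V y)
        y (curvature A y)) x :=
  mdifferentiableAt_twoForm (fun _ _ _ hX hY hs ↦ contMDiff_curvature_apply A hX hY hs) x

variable {A : CovariantDerivative I F V} [A.ContMDiffCovariantDerivative ∞]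
  {Φ : Π x : M, V x →L[ℝ] V x}

theorem endCov_apply (hΦ : ContMDiff I (I.prod 𝓘(ℝ, F →L[ℝ] F)) ∞
      (fun x ↦ (⟨x, Φ x⟩ : TotalSpace (F →L[ℝ] F) (fun x : M ↦ V x →L[ℝ] V x))))
    {s : Π x, V x} {x : M} (hs : MDiffAt (T% s) x) (X₀ : TangentSpace I x) :
    endCov A Φ x X₀ (s x) = A (fun y ↦ Φ y (s y)) x X₀ - Φ x (A s x X₀) :=
  homCov_apply A A ((hΦ x).mdifferentiableAt (by simp)) X₀ hs

theorem contMDiff_endCov_apply (hΦ : ContMDiff I (I.prod 𝓘(ℝ, F →L[ℝ] F)) ∞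
      (fun x ↦ (⟨x, Φ x⟩ : TotalSpace (F →L[ℝ] F) (fun x : M ↦ V x →L[ℝ] V x))))
    {X : Π x : M, TangentSpace I x} {s : Π x, V x} (hX : CMDiff ∞ (T% X))
    (hs : CMDiff ∞ (T% s)) : CMDiff ∞ (T% (fun y ↦ endCov A Φ y (X y) (s y))) := by
  simp_rw [fun y ↦ endCov_apply (A := A) hΦ ((hs y).mdifferentiableAt (by simp)) (X y)]
  have h₁ := contMDiff_cov_apply A hX (hΦ.clm_bundle_apply (F₁ := F) (F₂ := F) hs)
  have h₂ := hΦ.clm_bundle_apply (F₁ := F) (F₂ := F) (contMDiff_cov_apply A hX hs)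
  exact h₁.sub_section h₂

theorem mdifferentiableAt_endCov (hΦ : ContMDiff I (I.prod 𝓘(ℝ, F →L[ℝ] F)) ∞
      (fun x ↦ (⟨x, Φ x⟩ : TotalSpace (F →L[ℝ] F) (fun x : M ↦ V x →L[ℝ] V x)))) (x : M) :
    MDifferentiableAt I (I.prod 𝓘(ℝ, E →L[ℝ] F →L[ℝ] F))
      (fun y ↦ TotalSpace.mk' (E →L[ℝ] F →L[ℝ] F)
        (E := fun y : M ↦ TangentSpace I y →L[ℝ] V y →L[ℝ] V y) y (endCov A Φ y)) x :=
  mdifferentiableAt_oneForm (fun _ _ hX hs ↦ contMDiff_endCov_apply hΦ hX hs) x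

end DifferentiableTensors

/-! ### The Bianchi identity and the Ricci identity -/

section Bianchi

variable {E : Type*} [NormedAddCommGroup E] [NormedSpace ℝ E] [FiniteDimensional ℝ E]
  {H : Type*} [TopologicalSpace H] {I : ModelWithCorners ℝ E H}
  {M : Type*} [TopologicalSpace M] [ChartedSpace H M] [IsManifold I ∞ M]

theorem mlieBracket_jacobi {X Y Z : Π x : M, TangentSpace I x} (hX : CMDiff ∞ (T% X))
    (hY : CMDiff ∞ (T% Y)) (hZ : CMDiff ∞ (T% Z)) (x : M) :
    VectorField.mlieBracket I (VectorField.mlieBracket I X Y) Z x +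
      VectorField.mlieBracket I (VectorField.mlieBracket I Y Z) X x +
      VectorField.mlieBracket I (VectorField.mlieBracket I Z X) Y x = 0 := by
  have h2 {Z : Π x : M, TangentSpace I x} (hZ : CMDiff ∞ (T% Z)) :
      CMDiffAt (minSmoothness ℝ 2) (T% Z) x := by
    rw [minSmoothness_of_isRCLikeNormedField]
    exact (hZ x).of_le ENat.LEInfty.out
  have : IsManifold I (minSmoothness ℝ 3) M := by
    rw [minSmoothness_of_isRCLikeNormedField]; exact IsManifold.of_le (n := ∞) ENat.LEInfty.out
  have J := VectorField.leibniz_identity_mlieBracket_apply (h2 hX) (h2 hY) (h2 hZ)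
  have hd : MDiffAt (T% (VectorField.mlieBracket I X Z)) x :=
    (contMDiff_mlieBracket hX hZ x).mdifferentiableAt (by simp)
  have e₁ : VectorField.mlieBracket I (VectorField.mlieBracket I Y Z) X x =
      - VectorField.mlieBracket I X (VectorField.mlieBracket I Y Z) x := by
    rw [VectorField.mlieBracket_swap]; rfl
  have e₂ : VectorField.mlieBracket I (VectorField.mlieBracket I Z X) Y x =
      VectorField.mlieBracket I Y (VectorField.mlieBracket I X Z) x := by
    have : VectorField.mlieBracket I Z X = (-1 : ℝ) • VectorField.mlieBracket I X Z := by
      rw [VectorField.mlieBracket_swap, neg_one_smul]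
    rw [this, VectorField.mlieBracket_const_smul_left hd, VectorField.mlieBracket_swap]
    simp
  rw [e₁, e₂, J]
  abel

variable {F : Type*} [NormedAddCommGroup F] [NormedSpace ℝ F]
  {V : M → Type*} [TopologicalSpace (TotalSpace F V)]
  [∀ x, NormedAddCommGroup (V x)] [∀ x, InnerProductSpace ℝ (V x)]
  [FiberBundle F V] [VectorBundle ℝ F V]

theorem cov_sub (A : CovariantDerivative I F V) {s t : Π x, V x} {x : M}
    (hs : MDiffAt (T% s) x) (ht : MDiffAt (T% t) x) :
    A (fun y ↦ s y - t y) x = A s x - A t x := by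
  have h : (fun y ↦ s y - t y) = s + (-1 : ℝ) • t := by ext1 y; simp [sub_eq_add_neg]
  have hct : MDiffAt (T% ((-1 : ℝ) • t)) x := mdifferentiableAt_const.smul_section ht
  rw [h, A.isCovariantDerivativeOn.add hs hct (s := univ),
    A.isCovariantDerivativeOn.smul_const _ ht (s := univ)]
  simp [sub_eq_add_neg]

variable [FiniteDimensional ℝ F] [ContMDiffVectorBundle ∞ F V I] [T2Space M]

theorem curvature_swap (A : CovariantDerivative I F V) [A.ContMDiffCovariantDerivative ∞] (x : M)
    (X₀ Y₀ : TangentSpace I x) : curvature A x X₀ Y₀ = - curvature A x Y₀ X₀ := by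
  ext v
  rw [neg_apply, curvature_apply, curvature_apply, curvatureAux_swap]

theorem curvature_self (A : CovariantDerivative I F V) [A.ContMDiffCovariantDerivative ∞] (x : M)
    (X₀ : TangentSpace I x) : curvature A x X₀ X₀ = 0 := by
  have h := curvature_swap A x X₀ X₀
  rwa [eq_neg_iff_add_eq_zero, ← two_smul ℝ, smul_eq_zero_iff_right two_ne_zero] at h

variable [RiemannianBundle (fun x : M ↦ TangentSpace I x)]
  [IsContMDiffRiemannianBundle I 1 E (fun x : M ↦ TangentSpace I x)]
  (A : CovariantDerivative I F V)

theorem oneFormCov_apply {α : Π x : M, TangentSpace I x →L[ℝ] V x →L[ℝ] V x} {x : M}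
    (hα : MDifferentiableAt I (I.prod 𝓘(ℝ, E →L[ℝ] F →L[ℝ] F))
      (fun y ↦ TotalSpace.mk' (E →L[ℝ] F →L[ℝ] F)
        (E := fun y : M ↦ TangentSpace I y →L[ℝ] V y →L[ℝ] V y) y (α y)) x)
    (X₀ : TangentSpace I x) {Y : Π x : M, TangentSpace I x} {s : Π x, V x}
    (hY : MDiffAt (T% Y) x) (hs : MDiffAt (T% s) x) :
    oneFormCov A α x X₀ (Y x) (s x) = A (fun y ↦ α y (Y y) (s y)) x X₀ - α x (Y x) (A s x X₀) -
      α x (leviCivita Y x X₀) (s x) := by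
  have h₁ : oneFormCov A α x X₀ (Y x) =
      endCov A (fun y ↦ α y (Y y)) x X₀ - α x (leviCivita Y x X₀) :=
    homCov_apply (W := fun x : M ↦ V x →L[ℝ] V x) leviCivita (endCov A) hα X₀ hY
  have h₂ : endCov A (fun y ↦ α y (Y y)) x X₀ (s x) =
      A (fun y ↦ α y (Y y) (s y)) x X₀ - α x (Y x) (A s x X₀) :=
    homCov_apply A A (hα.clm_bundle_apply (F₁ := E) (F₂ := F →L[ℝ] F)
      (E₂ := fun x : M ↦ V x →L[ℝ] V x) hY) X₀ hs
  rw [h₁, sub_apply, h₂]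

theorem twoFormCov_apply
    {η : Π x : M, TangentSpace I x →L[ℝ] TangentSpace I x →L[ℝ] V x →L[ℝ] V x} {x : M}
    (hη : MDifferentiableAt I (I.prod 𝓘(ℝ, E →L[ℝ] E →L[ℝ] F →L[ℝ] F))
      (fun y ↦ TotalSpace.mk' (E →L[ℝ] E →L[ℝ] F →L[ℝ] F)
        (E := fun y : M ↦ TangentSpace I y →L[ℝ] TangentSpace I y →L[ℝ] V y →L[ℝ] V y)
        y (η y)) x)
    (X₀ : TangentSpace I x) {Y Z : Π x : M, TangentSpace I x} {s : Π x, V x}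
    (hY : MDiffAt (T% Y) x) (hZ : MDiffAt (T% Z) x) (hs : MDiffAt (T% s) x) :
    twoFormCov A η x X₀ (Y x) (Z x) (s x) =
      A (fun y ↦ η y (Y y) (Z y) (s y)) x X₀ - η x (Y x) (Z x) (A s x X₀) -
      η x (Y x) (leviCivita Z x X₀) (s x) - η x (leviCivita Y x X₀) (Z x) (s x) := by
  have h₁ : twoFormCov A η x X₀ (Y x) =
      oneFormCov A (fun y ↦ η y (Y y)) x X₀ - η x (leviCivita Y x X₀) :=
    homCov_apply (W := fun x : M ↦ TangentSpace I x →L[ℝ] V x →L[ℝ] V x) leviCivita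
      (oneFormCov A) hη X₀ hY
  rw [h₁, sub_apply, sub_apply,
    oneFormCov_apply A (hη.clm_bundle_apply (F₁ := E) (F₂ := E →L[ℝ] F →L[ℝ] F)
      (E₂ := fun x : M ↦ TangentSpace I x →L[ℝ] V x →L[ℝ] V x) hY) X₀ hZ hs]

theorem leviCivita_sub_leviCivita {X Y : Π x : M, TangentSpace I x} {x : M}
    (hX : MDiffAt (T% X) x) (hY : MDiffAt (T% Y) x) :
    leviCivita Y x (X x) - leviCivita X x (Y x) = VectorField.mlieBracket I X Y x :=
  (CovariantDerivative.torsion_eq_zero_iff _).1 leviCivita_torsion hX hY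

variable [A.ContMDiffCovariantDerivative ∞]

/-- Expand on smooth fields and a smooth section. In the cyclic sum the third derivatives of `s`
cancel; the Levi-Civita terms combine, by absence of torsion, to the curvature on `[X, Y]` and `Z`
and its cyclic images; what survives is the derivative of `s` along the Jacobi sum of brackets,
which is zero. -/
theorem bianchi (x : M) (X₀ Y₀ Z₀ : TangentSpace I x) :
    twoFormCov A (curvature A) x X₀ Y₀ Z₀ + twoFormCov A (curvature A) x Y₀ Z₀ X₀ +
      twoFormCov A (curvature A) x Z₀ X₀ Y₀ = 0 := by
  obtain ⟨X, hX, -, rfl⟩ := exists_contMDiff_extend I E X₀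
  obtain ⟨Y, hY, -, rfl⟩ := exists_contMDiff_extend I E Y₀
  obtain ⟨Z, hZ, -, rfl⟩ := exists_contMDiff_extend I E Z₀
  ext v
  obtain ⟨s, hs, -, rfl⟩ := exists_contMDiff_extend I F v
  have hdT {X : Π x : M, TangentSpace I x} (hX : CMDiff ∞ (T% X)) : MDiffAt (T% X) x :=
    (hX x).mdifferentiableAt (by simp)
  have hd {s : Π x, V x} (hs : CMDiff ∞ (T% s)) : MDiffAt (T% s) x :=
    (hs x).mdifferentiableAt (by simp)
  have expand {X Y Z : Π x : M, TangentSpace I x} (hX : CMDiff ∞ (T% X)) (hY : CMDiff ∞ (T% Y))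
      (hZ : CMDiff ∞ (T% Z)) : twoFormCov A (curvature A) x (X x) (Y x) (Z x) (s x) =
        A (fun y ↦ A (fun z ↦ A s z (Z z)) y (Y y)) x (X x) -
        A (fun y ↦ A (fun z ↦ A s z (Y z)) y (Z y)) x (X x) -
        A (fun y ↦ A s y (VectorField.mlieBracket I Y Z y)) x (X x) -
        curvatureAux A Y Z (fun y ↦ A s y (X y)) x -
        curvature A x (Y x) (leviCivita Z x (X x)) (s x) -
        curvature A x (leviCivita Y x (X x)) (Z x) (s x) := by
    rw [twoFormCov_apply A (mdifferentiableAt_curvature A x) _ (hdT hY) (hdT hZ) (hd hs)]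
    have h₁ := curvature_apply_of_contMDiff A (contMDiff_cov_apply A hX hs) hY hZ x
    simp only [fun y ↦ curvature_apply_of_contMDiff A hs hY hZ y]
    rw [h₁]
    have hYZ := contMDiff_cov_apply A hY (contMDiff_cov_apply A hZ hs)
    have hZY := contMDiff_cov_apply A hZ (contMDiff_cov_apply A hY hs)
    have hb := contMDiff_cov_apply A (contMDiff_mlieBracket hY hZ) hs
    simp only [curvatureAux]
    have hsub : CMDiff ∞ (T% (fun y ↦ A (fun y ↦ A s y (Z y)) y (Y y) -
        A (fun y ↦ A s y (Y y)) y (Z y))) := hYZ.sub_section hZY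
    rw [cov_sub A (hd hsub) (hd hb), cov_sub A (hd hYZ) (hd hZY)]
    simp
  have tors {X Y Z : Π x : M, TangentSpace I x} (hX : CMDiff ∞ (T% X)) (hY : CMDiff ∞ (T% Y))
      (hZ : CMDiff ∞ (T% Z)) : curvature A x (leviCivita Y x (X x)) (Z x) (s x) +
        curvature A x (Z x) (leviCivita X x (Y x)) (s x) =
        curvatureAux A (VectorField.mlieBracket I X Y) Z s x := by
    rw [← curvature_apply_of_contMDiff A hs (contMDiff_mlieBracket hX hY) hZ,
      ← leviCivita_sub_leviCivita (hdT hX) (hdT hY), curvature_swap A x (Z x)]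
    simp [sub_eq_add_neg]
  have t₁ := tors hX hY hZ
  have t₂ := tors hY hZ hX
  have t₃ := tors hZ hX hY
  have J := congrArg (A s x) (mlieBracket_jacobi hX hY hZ x)
  simp only [map_add, map_zero] at J
  simp only [add_apply, zero_apply, expand hX hY hZ, expand hY hZ hX, expand hZ hX hY]
  simp only [curvatureAux] at t₁ t₂ t₃ ⊢
  rw [← sub_eq_zero] at t₁ t₂ t₃
  -- This combination of vanishing expressions is minus the expanded cyclic sum.
  have key := congrArg₂ (· - ·) (congrArg₂ (· + ·) (congrArg₂ (· + ·) t₁ t₂) t₃) J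
  simp only [add_zero, sub_zero] at key
  rw [← neg_eq_zero, ← key]
  abel

/-- The Ricci identity: the curvature of the connection on `End V` acts by commutator. Second
derivatives of `Φ s` give `F (Φ s)`, those of `s` give `Φ (F s)`, the mixed first-order terms
cancel, and the Levi-Civita terms form the bracket because the torsion vanishes. -/
theorem oneFormCov_endCov_sub {Φ : Π x : M, V x →L[ℝ] V x}
    (hΦ : ContMDiff I (I.prod 𝓘(ℝ, F →L[ℝ] F)) ∞
      (fun x ↦ (⟨x, Φ x⟩ : TotalSpace (F →L[ℝ] F) (fun x : M ↦ V x →L[ℝ] V x))))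
    (x : M) (X₀ Y₀ : TangentSpace I x) :
    oneFormCov A (endCov A Φ) x X₀ Y₀ - oneFormCov A (endCov A Φ) x Y₀ X₀ =
      ⁅curvature A x X₀ Y₀, Φ x⁆ := by
  obtain ⟨X, hX, -, rfl⟩ := exists_contMDiff_extend I E X₀
  obtain ⟨Y, hY, -, rfl⟩ := exists_contMDiff_extend I E Y₀
  ext v
  obtain ⟨s, hs, -, rfl⟩ := exists_contMDiff_extend I F v
  have hdT {X : Π x : M, TangentSpace I x} (hX : CMDiff ∞ (T% X)) : MDiffAt (T% X) x :=
    (hX x).mdifferentiableAt (by simp)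
  have hd {s : Π x, V x} (hs : CMDiff ∞ (T% s)) (y : M) : MDiffAt (T% s) y :=
    (hs y).mdifferentiableAt (by simp)
  have hΦs {s : Π x, V x} (hs : CMDiff ∞ (T% s)) : CMDiff ∞ (T% (fun y ↦ Φ y (s y))) :=
    hΦ.clm_bundle_apply (F₁ := F) (F₂ := F) hs
  have expand {X Y : Π x : M, TangentSpace I x} (hX : CMDiff ∞ (T% X)) (hY : CMDiff ∞ (T% Y)) :
      oneFormCov A (endCov A Φ) x (X x) (Y x) (s x) =
        A (fun y ↦ A (fun z ↦ Φ z (s z)) y (Y y)) x (X x) -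
        A (fun y ↦ Φ y (A s y (Y y))) x (X x) -
        (A (fun y ↦ Φ y (A s y (X y))) x (Y x) - Φ x (A (fun y ↦ A s y (X y)) x (Y x))) -
        endCov A Φ x (leviCivita Y x (X x)) (s x) := by
    rw [oneFormCov_apply A (mdifferentiableAt_endCov hΦ x) _ (hdT hY) (hd hs x)]
    have h₁ := endCov_apply (A := A) hΦ (hd (contMDiff_cov_apply A hX hs) x) (Y x)
    simp only [fun y ↦ endCov_apply (A := A) hΦ (hd hs y) (Y y), h₁]
    rw [cov_sub A (hd (contMDiff_cov_apply A hY (hΦs hs)) x)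
      (hd (hΦs (contMDiff_cov_apply A hY hs)) x)]
    simp
  have h₁ := curvature_apply_of_contMDiff A (hΦs hs) hX hY x
  have h₂ := curvature_apply_of_contMDiff A hs hX hY x
  have h₃ := endCov_apply (A := A) hΦ (hd hs x) (VectorField.mlieBracket I X Y x)
  rw [← leviCivita_sub_leviCivita (hdT hX) (hdT hY)] at h₃
  simp only [map_sub, sub_apply] at h₃
  have lie : ⁅curvature A x (X x) (Y x), Φ x⁆ (s x) =
      curvature A x (X x) (Y x) (Φ x (s x)) - Φ x (curvature A x (X x) (Y x) (s x)) := rfl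
  rw [sub_apply, expand hX hY, expand hY hX, lie, h₁, h₂, curvatureAux, curvatureAux,
    ← leviCivita_sub_leviCivita (hdT hX) (hdT hY)]
  simp only [map_sub]
  rw [← sub_eq_zero] at h₃ ⊢
  rw [← neg_eq_zero, ← h₃]
  abel

end Bianchi

/-! ### Differentials of real functions -/

section ScalarFunctions

variable {E : Type*} [NormedAddCommGroup E] [NormedSpace ℝ E]
  {H : Type*} [TopologicalSpace H] {I : ModelWithCorners ℝ E H}
  {M : Type*} [TopologicalSpace M] [ChartedSpace H M] {x : M}

theorem mvfderiv_real_comp {g : M → ℝ} {h : ℝ → ℝ} {h' : ℝ} (hg : MDiffAt g x)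
    (hh : HasDerivAt h h' (g x)) :
    MDiffAt (fun y ↦ h (g y)) x ∧ mvfderiv I (fun y ↦ h (g y)) x = h' • mvfderiv I g x := by
  have h₁ := hh.hasFDerivAt.hasMFDerivAt.comp x hg.hasMFDerivAt
  refine ⟨h₁.mdifferentiableAt, ?_⟩
  ext v
  have h₂ := congrArg (fun L ↦ L v) h₁.mfderiv
  simp only [mvfderiv]
  change mfderiv I 𝓘(ℝ, ℝ) (h ∘ g) x v = h' * (show ℝ from mfderiv I 𝓘(ℝ, ℝ) g x v)
  rw [mul_comm]
  exact h₂

theorem mvfderiv_congr_of_eventuallyEq {f g : M → ℝ} (h : f =ᶠ[𝓝 x] g) :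
    mvfderiv I f x = mvfderiv I g x := by
  ext v
  have := congrArg (fun L ↦ L v) (h.mfderiv_eq (I := I) (I' := 𝓘(ℝ, ℝ)))
  exact this

/-- A linear form of the chart coordinates centred at `x`. Such functions serve to correct sections
to first order in `exists_isParallelAt`. -/
theorem exists_mvfderiv_eq (ξ : TangentSpace I x →L[ℝ] ℝ) :
    ∃ g : M → ℝ, MDiffAt g x ∧ g x = 0 ∧ mvfderiv I g x = ξ := by
  let L : E →L[ℝ] ℝ := ξ
  let g : M → ℝ := fun y ↦ L (extChartAt I x y - extChartAt I x x)
  have hg : HasMFDerivAt I 𝓘(ℝ, ℝ) g x L := by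
    refine ⟨?_, ?_⟩
    · exact L.continuous.continuousAt.comp
        ((continuousAt_extChartAt (I := I) x).sub continuousAt_const)
    · have h₀ : HasFDerivWithinAt (fun z ↦ L (z - extChartAt I x x)) L (range I)
          (extChartAt I x x) := by
        have := (L.hasFDerivWithinAt (s := range I) (x := extChartAt I x x)).sub_const
          (L (extChartAt I x x))
        simpa using! this
      refine h₀.congr_of_eventuallyEq ?_ ?_
      · filter_upwards [extChartAt_target_mem_nhdsWithin (I := I) x] with z hz
        change L (extChartAt I x ((extChartAt I x).symm z) - extChartAt I x x) = _
        rw [(extChartAt I x).right_inv hz]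
      · change L (extChartAt I x ((extChartAt I x).symm (extChartAt I x x)) - extChartAt I x x) = _
        rw [extChartAt_to_inv]
  refine ⟨g, hg.mdifferentiableAt, by simp [g], ?_⟩
  ext v
  have := congrArg (fun L ↦ L v) hg.mfderiv
  exact this

end ScalarFunctions

/-! ### Orthonormal frames parallel at a point -/

section ParallelFrames

variable {E : Type*} [NormedAddCommGroup E] [NormedSpace ℝ E]
  {H : Type*} [TopologicalSpace H] {I : ModelWithCorners ℝ E H}
  {M : Type*} [TopologicalSpace M] [ChartedSpace H M]
  {F : Type*} [NormedAddCommGroup F] [NormedSpace ℝ F]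
  {V : M → Type*} [TopologicalSpace (TotalSpace F V)]
  [∀ x, NormedAddCommGroup (V x)] [∀ x, InnerProductSpace ℝ (V x)]
  [FiberBundle F V]

/-- A section is parallel at a point if it is differentiable there, with vanishing covariant
derivative. -/
def IsParallelAt (A : CovariantDerivative I F V) (s : Π x, V x) (x : M) : Prop :=
  MDiffAt (T% s) x ∧ A s x = 0

/-- The product rule `d⟪s, t⟫ = ⟪∇s, t⟫ + ⟪s, ∇t⟫` at a point. -/
def IsMetricAt (A : CovariantDerivative I F V) (x : M) : Prop :=
  ∀ {s t : Π x, V x}, MDiffAt (T% s) x → MDiffAt (T% t) x → ∀ X₀ : TangentSpace I x,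
    mvfderiv I (fun y ↦ inner ℝ (s y) (t y)) x X₀ =
      inner ℝ (A s x X₀) (t x) + inner ℝ (s x) (A t x X₀)

variable {A : CovariantDerivative I F V} {s t : Π x, V x} {x : M}

theorem IsParallelAt.smul {f : M → ℝ} (hs : IsParallelAt A s x) (hf : MDiffAt f x)
    (hdf : mvfderiv I f x = 0) [VectorBundle ℝ F V] :
    IsParallelAt A (fun y ↦ f y • s y) x := by
  refine ⟨hf.smul_section hs.1, ?_⟩
  change A (f • s) x = 0
  rw [A.isCovariantDerivativeOn.leibniz hs.1 hf (s := univ), hs.2, hdf]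
  ext; simp

variable [VectorBundle ℝ F V]

theorem IsParallelAt.sub (hs : IsParallelAt A s x) (ht : IsParallelAt A t x) :
    IsParallelAt A (fun y ↦ s y - t y) x := by
  have h : (fun y ↦ s y - t y) = s + (-1 : ℝ) • t := by ext1 y; simp [sub_eq_add_neg]
  have hct : MDiffAt (T% ((-1 : ℝ) • t)) x := mdifferentiableAt_const.smul_section ht.1
  rw [h]
  refine ⟨mdifferentiableAt_add_section hs.1 hct, ?_⟩
  rw [A.isCovariantDerivativeOn.add hs.1 hct (s := univ),
    A.isCovariantDerivativeOn.smul_const _ ht.1 (s := univ), hs.2, ht.2]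
  simp

theorem IsParallelAt.sum {ι : Type*} {S : Finset ι} {t : ι → Π x, V x}
    (ht : ∀ i ∈ S, IsParallelAt A (t i) x) : IsParallelAt A (fun y ↦ ∑ i ∈ S, t i y) x := by
  classical
  induction S using Finset.induction_on with
  | empty =>
    refine ⟨by simpa using! mdifferentiableAt_zeroSection .., ?_⟩
    have : (fun y ↦ ∑ i ∈ (∅ : Finset ι), t i y) = 0 := by ext1 y; simp
    rw [this, A.zero]; rfl
  | insert i S hi ih =>
    simp only [Finset.sum_insert hi]
    have h₁ := ht i (Finset.mem_insert_self _ _)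
    have h₂ := ih fun j hj ↦ ht j (Finset.mem_insert_of_mem hj)
    refine ⟨mdifferentiableAt_add_section h₁.1 h₂.1, ?_⟩
    change A (t i + fun y ↦ ∑ i ∈ S, t i y) x = 0
    rw [A.isCovariantDerivativeOn.add h₁.1 h₂.1 (s := univ), h₁.2, h₂.2, add_zero]

variable [FiniteDimensional ℝ F] [ContMDiffVectorBundle 1 F V I]

/-- From `extend F v` subtract `∑ g i • extend F (b i)`, where `g i` vanishes at `x` and its
differential is the `i`-th coefficient of `∇ (extend F v)`. Only first order at `x` matters, so no
parallel transport is needed. -/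
theorem exists_isParallelAt (A : CovariantDerivative I F V) {x : M} (v : V x) :
    ∃ s : Π x, V x, IsParallelAt A s x ∧ s x = v := by
  have : FiniteDimensional ℝ (V x) := VectorBundle.finiteDimensional ℝ F V x
  let b := Module.finBasis ℝ (V x)
  have hd (w : V x) : MDiffAt (T% (extend F w)) x := mdifferentiableAt_extend ..
  choose g hg hg0 hdg using fun i ↦ exists_mvfderiv_eq (I := I)
    ((LinearMap.toContinuousLinearMap (b.coord i)).comp (A (extend F v) x))
  let τ : Π x, V x := ∑ i, (g i • extend F (b i))
  have hτi (i) : MDiffAt (T% (g i • extend F (b i))) x := (hg i).smul_section (hd (b i))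
  have key (S : Finset (Fin (Module.finrank ℝ (V x)))) :
      MDiffAt (T% (∑ i ∈ S, (g i • extend F (b i)))) x ∧
      A (∑ i ∈ S, (g i • extend F (b i))) x = ∑ i ∈ S, (mvfderiv I (g i) x).smulRight (b i) := by
    classical
    induction S using Finset.induction_on with
    | empty => exact ⟨by simpa using! mdifferentiableAt_zeroSection .., by simp⟩
    | insert i S hi ih =>
      simp only [Finset.sum_insert hi]
      refine ⟨mdifferentiableAt_add_section (hτi i) ih.1, ?_⟩
      rw [A.isCovariantDerivativeOn.add (hτi i) ih.1 (s := univ), ih.2,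
        A.isCovariantDerivativeOn.leibniz (hd (b i)) (hg i) (s := univ), hg0]
      simp
  have hneg : MDiffAt (T% ((-1 : ℝ) • τ)) x :=
    mdifferentiableAt_const.smul_section (key Finset.univ).1
  refine ⟨extend F v + (-1 : ℝ) • τ, ⟨mdifferentiableAt_add_section (hd v) hneg, ?_⟩, ?_⟩
  · rw [A.isCovariantDerivativeOn.add (hd v) hneg (s := univ),
      A.isCovariantDerivativeOn.smul_const _ (key Finset.univ).1 (s := univ), (key Finset.univ).2]
    ext X₀
    simp only [add_apply, smul_apply, sum_apply, ContinuousLinearMap.smulRight_apply, hdg]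
    have := b.sum_repr (A (extend F v) x X₀)
    simp [this]
  · simp [τ, hg0]

variable [IsContMDiffRiemannianBundle I 1 F V]

theorem IsMetricAt.mvfderiv_inner_eq_zero (hA : IsMetricAt A x) (hs : IsParallelAt A s x)
    (ht : IsParallelAt A t x) : mvfderiv I (fun y ↦ inner ℝ (s y) (t y)) x = 0 := by
  ext X₀
  rw [hA hs.1 ht.1, hs.2, ht.2]
  simp

/-- Gram–Schmidt applied to sections parallel at `x`. Their inner products have zero differential at
`x`, so the orthogonalised and normalised sections stay parallel there; the values at `x` do not
change since `b` is already orthonormal. -/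
theorem exists_parallel_orthonormal_frame (hA : IsMetricAt A x) {d : ℕ}
    (b : OrthonormalBasis (Fin d) ℝ (V x)) :
    ∃ e : Fin d → Π x, V x, (∀ i, IsParallelAt A (e i) x) ∧ (∀ i, e i x = b i) ∧
      ∀ᶠ y in 𝓝 x, ∃ c : OrthonormalBasis (Fin d) ℝ (V y), ∀ i, c i = e i y := by
  choose s hs hsx using fun i ↦ exists_isParallelAt A (b i)
  have hin {s t : Π x, V x} (hs : IsParallelAt A s x) (ht : IsParallelAt A t x) :
      MDiffAt (fun y ↦ inner ℝ (s y) (t y)) x :=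
    MDifferentiableAt.inner_bundle (F := F) (E := V) hs.1 ht.1
  set u : Fin d → Π y, V y := fun i y ↦ InnerProductSpace.gramSchmidt ℝ (fun j ↦ s j y) i with hu
  have hux (i : Fin d) : u i x = b i := by
    have : (fun j ↦ s j x) = b := funext hsx
    simp only [hu, this]
    rw [InnerProductSpace.gramSchmidt_of_orthogonal]
    exact fun i j hij ↦ b.orthonormal.2 hij
  set r : Fin d → M → ℝ := fun i y ↦ (√(inner ℝ (u i y) (u i y)))⁻¹ with hr
  have hix (i : Fin d) : inner ℝ (u i x) (u i x) = (1 : ℝ) := by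
    rw [hux, real_inner_self_eq_norm_sq, b.orthonormal.1]; simp
  have hup (i : Fin d) : IsParallelAt A (u i) x := by
    refine WellFoundedLT.induction (motive := fun i ↦ IsParallelAt A (u i) x) i fun i ih ↦ ?_
    have e : u i = fun y ↦ s i y - ∑ j ∈ Finset.Iio i,
        (inner ℝ (u j y) (s i y) * (inner ℝ (u j y) (u j y))⁻¹) • u j y := by
      ext1 y
      rw [hu, eq_sub_iff_add_eq]
      conv_rhs => rw [InnerProductSpace.gramSchmidt_def'' ℝ (fun j ↦ s j y) i]
      simp [div_eq_mul_inv]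
    rw [e]
    refine (hs i).sub (IsParallelAt.sum fun j hj ↦ ?_)
    have hj := Finset.mem_Iio.1 hj
    have hp := hin (ih j hj) (hs i)
    have hdp := hA.mvfderiv_inner_eq_zero (ih j hj) (hs i)
    have hpx : inner ℝ (u j x) (s i x) = (0 : ℝ) := by
      rw [hux, hsx]; exact b.orthonormal.2 hj.ne
    have hq := (mvfderiv_real_comp (hin (ih j hj) (ih j hj))
      (hasDerivAt_inv (by rw [hix]; exact one_ne_zero))).1
    refine (ih j hj).smul (hp.mul hq) ?_
    -- The first factor vanishes at `x` together with its differential, so the differential of the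
    -- second factor plays no role.
    have h := mvfderiv_fun_mul hp hq
    rw [hpx, hdp] at h
    simpa using! h
  have hrd (i : Fin d) : MDiffAt (r i) x ∧ mvfderiv I (r i) x = 0 := by
    have h₁ : DifferentiableAt ℝ (fun z : ℝ ↦ (√z)⁻¹) (inner ℝ (u i x) (u i x)) := by
      rw [hix]
      exact ((Real.hasDerivAt_sqrt one_ne_zero).inv (by simp)).differentiableAt
    have h₂ := mvfderiv_real_comp (hin (hup i) (hup i)) h₁.hasDerivAt
    rw [hA.mvfderiv_inner_eq_zero (hup i) (hup i), smul_zero] at h₂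
    exact h₂
  refine ⟨fun i y ↦ r i y • u i y, fun i ↦ (hup i).smul (hrd i).1 (hrd i).2, fun i ↦ ?_, ?_⟩
  · simp [hr, hux, b.orthonormal.1]
  · have hpos : ∀ᶠ y in 𝓝 x, ∀ i, inner ℝ (u i y) (u i y) ≠ (0 : ℝ) := by
      refine Filter.eventually_all.2 fun i ↦ ?_
      exact (hin (hup i) (hup i)).continuousAt.eventually_ne (by rw [hix]; simp)
    filter_upwards [hpos] with y hy
    have : FiniteDimensional ℝ (V y) := VectorBundle.finiteDimensional ℝ F V y
    have hon : Orthonormal ℝ (fun i ↦ r i y • u i y) := by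
      refine ⟨fun i ↦ ?_, fun i j hij ↦ ?_⟩
      · have : ‖u i y‖ ≠ 0 := fun h ↦ hy i (by rw [real_inner_self_eq_norm_sq, h]; simp)
        simp [hr, norm_smul, this]
      · have : inner ℝ (u i y) (u j y) = (0 : ℝ) := InnerProductSpace.gramSchmidt_orthogonal ℝ _ hij
        simp [real_inner_smul_left, real_inner_smul_right, this]
    have hcard : Module.finrank ℝ (V y) = Fintype.card (Fin d) := by
      have h₁ := ((trivializationAt F V y).linearEquivAt ℝ y
        (mem_baseSet_trivializationAt' y)).finrank_eq
      have h₂ := ((trivializationAt F V x).linearEquivAt ℝ x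
        (mem_baseSet_trivializationAt' x)).finrank_eq
      rw [h₁, ← h₂, Module.finrank_eq_card_basis b.toBasis]
    obtain ⟨c, hc⟩ := Orthonormal.exists_orthonormalBasis_extension_of_card_eq hcard
      (v := fun i ↦ r i y • u i y) (s := univ) (hon.comp _ Subtype.coe_injective)
    exact ⟨c, fun i ↦ hc i (mem_univ i)⟩

end ParallelFrames

/-! ### Differentiability of norms and the Cauchy–Schwarz bound -/

section NormDerivative

variable {E : Type*} [NormedAddCommGroup E] [NormedSpace ℝ E]
  {H : Type*} [TopologicalSpace H] {I : ModelWithCorners ℝ E H}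
  {M : Type*} [TopologicalSpace M] [ChartedSpace H M] {x : M}

theorem mvfderiv_finset_sum {ι : Type*} (S : Finset ι) {f : ι → M → ℝ}
    (hf : ∀ i, MDiffAt (f i) x) :
    MDiffAt (fun y ↦ ∑ i ∈ S, f i y) x ∧ ∀ X₀ : TangentSpace I x,
      mvfderiv I (fun y ↦ ∑ i ∈ S, f i y) x X₀ = ∑ i ∈ S, mvfderiv I (f i) x X₀ := by
  classical
  induction S using Finset.induction_on with
  | empty =>
    simp only [Finset.sum_empty]
    exact ⟨mdifferentiableAt_const, fun X₀ ↦ by rw [mvfderiv_const]; rfl⟩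
  | insert i S hi ih =>
    simp only [Finset.sum_insert hi]
    refine ⟨(hf i).add ih.1, fun X₀ ↦ ?_⟩
    rw [mvfderiv_fun_add (hf i) ih.1, add_apply, ih.2]

variable {F : Type*} [NormedAddCommGroup F] [NormedSpace ℝ F]
  {V : M → Type*} [TopologicalSpace (TotalSpace F V)]
  [∀ x, NormedAddCommGroup (V x)] [∀ x, InnerProductSpace ℝ (V x)]
  [FiberBundle F V] [VectorBundle ℝ F V] [IsContMDiffRiemannianBundle I 1 F V]
  {A : CovariantDerivative I F V}

/-- With `q = ∑ ‖f p‖²`, metricity gives `dq = 2 ∑ ⟪∇ f p, f p⟫`, and Cauchy–Schwarz bounds `(dN)² =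
c (dq)² / (4q)`. The constant `c` allows for the factor `1/2` in the norm of two-forms. -/
theorem sq_mvfderiv_norm_le (hA : IsMetricAt A x) {P : Type*} [Fintype P] {f : P → Π y, V y}
    (hf : ∀ p, MDiffAt (T% (f p)) x) {c : ℝ} (hc : 0 < c) {N : M → ℝ}
    (hN : ∀ᶠ y in 𝓝 x, N y = √(c * ∑ p, ‖f p y‖ ^ 2)) (hpos : 0 < ∑ p, ‖f p x‖ ^ 2) :
    MDiffAt N x ∧ ∀ X₀ : TangentSpace I x,
      mvfderiv I N x X₀ ^ 2 ≤ c * ∑ p, ‖A (f p) x X₀‖ ^ 2 := by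
  set q : M → ℝ := fun y ↦ ∑ p, inner ℝ (f p y) (f p y) with hq
  have hqx (y : M) : q y = ∑ p, ‖f p y‖ ^ 2 := by simp [hq]
  obtain ⟨hqd, hqX⟩ := mvfderiv_finset_sum (I := I) (x := x) Finset.univ
    (f := fun p y ↦ inner ℝ (f p y) (f p y))
    fun p ↦ MDifferentiableAt.inner_bundle (F := F) (E := V) (hf p) (hf p)
  have hqx0 : 0 < q x := by rw [hqx]; exact hpos
  have hder : HasDerivAt (fun z ↦ √(c * z)) (c / (2 * √(c * q x))) (q x) := by
    have := ((hasDerivAt_id (q x)).const_mul c).sqrt (by simp; exact ⟨hc.ne', hqx0.ne'⟩)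
    simpa using this
  obtain ⟨hd, hdX⟩ := mvfderiv_real_comp hqd hder
  have hNe : N =ᶠ[𝓝 x] fun y ↦ √(c * q y) := by
    filter_upwards [hN] with y hy
    rw [hy, hqx]
  refine ⟨hd.congr_of_eventuallyEq hNe, fun X₀ ↦ ?_⟩
  rw [mvfderiv_congr_of_eventuallyEq hNe, hdX, smul_apply, hqX]
  have hsum : ∑ p, mvfderiv I (fun y ↦ inner ℝ (f p y) (f p y)) x X₀ =
      2 * ∑ p, inner ℝ (A (f p) x X₀) (f p x) := by
    rw [Finset.mul_sum]
    refine Finset.sum_congr rfl fun p _ ↦ ?_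
    rw [hA (hf p) (hf p), real_inner_comm]
    ring
  rw [hsum]
  have hcs := sq_sum_inner_le (fun p ↦ A (f p) x X₀) (fun p ↦ f p x)
  rw [← hqx] at hcs
  set S := ∑ p, inner ℝ (A (f p) x X₀) (f p x)
  have hsq : √(c * q x) ^ 2 = c * q x := Real.sq_sqrt (by positivity)
  have : ((c / (2 * √(c * q x))) • (2 * S)) ^ 2 = c * (S ^ 2 / q x) := by
    rw [smul_eq_mul, mul_pow, div_pow, mul_pow, hsq]
    field_simp
  rw [this]
  gcongr
  rwa [div_le_iff₀ hqx0]

end NormDerivative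

/-! ### Norms and codifferentials in arbitrary orthonormal bases -/

section NormFormulas

theorem sum_sum_norm_sq_orthonormalBasis_eq {T W ι κ P : Type*} [NormedAddCommGroup T]
    [InnerProductSpace ℝ T] [FiniteDimensional ℝ T] [NormedAddCommGroup W] [InnerProductSpace ℝ W]
    [Fintype ι] [Fintype κ] [Fintype P] (L : P → T → W) (hL : ∀ p, IsLinearMap ℝ (L p))
    (b : OrthonormalBasis ι ℝ T) (c : OrthonormalBasis κ ℝ T) :
    ∑ i, ∑ p, ‖L p (b i)‖ ^ 2 = ∑ k, ∑ p, ‖L p (c k)‖ ^ 2 := by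
  rw [Finset.sum_comm]
  conv_rhs => rw [Finset.sum_comm]
  exact Finset.sum_congr rfl fun p _ ↦ sum_norm_sq_orthonormalBasis_eq ((hL p).mk' _) b c

theorem clm_eq_zero_of_orthonormalBasis {T W ι : Type*} [NormedAddCommGroup T]
    [InnerProductSpace ℝ T] [Fintype ι] [AddCommGroup W] [Module ℝ W] [TopologicalSpace W]
    (b : OrthonormalBasis ι ℝ T) (L : T →L[ℝ] W) (h : ∀ i, L (b i) = 0) : L = 0 := by
  refine ContinuousLinearMap.coe_injective (b.toBasis.ext fun i ↦ ?_)
  simpa using h i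

variable {E : Type*} [NormedAddCommGroup E] [NormedSpace ℝ E] [FiniteDimensional ℝ E]
  {H : Type*} [TopologicalSpace H] {I : ModelWithCorners ℝ E H}
  {M : Type*} [TopologicalSpace M] [ChartedSpace H M] [IsManifold I ∞ M]
  [RiemannianBundle (fun x : M ↦ TangentSpace I x)]
  {F : Type*} [NormedAddCommGroup F] [NormedSpace ℝ F] [FiniteDimensional ℝ F]
  {V : M → Type*} [TopologicalSpace (TotalSpace F V)]
  [∀ x, NormedAddCommGroup (V x)] [∀ x, InnerProductSpace ℝ (V x)]
  [FiberBundle F V] [VectorBundle ℝ F V]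
  {x : M} {ι κ : Type*} [Fintype ι] [Fintype κ]
  (b : OrthonormalBasis ι ℝ (TangentSpace I x)) (v : OrthonormalBasis κ ℝ (V x))

theorem covectorNormSq_eq (ξ : TangentSpace I x →L[ℝ] ℝ) :
    covectorNormSq ξ = ∑ i, ξ (b i) ^ 2 := by
  have h := sum_norm_sq_orthonormalBasis_eq ξ.toLinearMap
    (stdOrthonormalBasis ℝ (TangentSpace I x)) b
  simpa [covectorNormSq] using h

theorem endNormSq_eq (B : V x →L[ℝ] V x) : endNormSq F B = ∑ l, ‖B (v l)‖ ^ 2 :=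
  haveI : FiniteDimensional ℝ (V x) := VectorBundle.finiteDimensional ℝ F V x
  sum_norm_sq_orthonormalBasis_eq B.toLinearMap (stdOrthonormalBasis ℝ (V x)) v

theorem oneFormNormSq_eq {α : TangentSpace I x → (V x →L[ℝ] V x)} (hα : IsLinearMap ℝ α) :
    oneFormNormSq I F α = ∑ p : κ × ι, ‖α (b p.2) (v p.1)‖ ^ 2 := by
  simp only [oneFormNormSq, endNormSq_eq v]
  rw [sum_sum_norm_sq_orthonormalBasis_eq (fun l X ↦ α X (v l))
    (fun l ↦ ⟨fun X Y ↦ by simp [hα.map_add], fun r X ↦ by simp [hα.map_smul]⟩) _ b,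
    Finset.sum_comm, Fintype.sum_prod_type]

/-- The basis is changed one slot at a time. The freedom is needed twice: for the basis adapted to
the gradient at `x`, and for the moving frame at nearby points. -/
theorem twoFormNormSq_eq {η : TangentSpace I x → TangentSpace I x → (V x →L[ℝ] V x)}
    (hη₁ : ∀ Y, IsLinearMap ℝ fun X ↦ η X Y) (hη₂ : ∀ X, IsLinearMap ℝ (η X)) :
    twoFormNormSq I F η = 2⁻¹ * ∑ p : κ × ι × ι, ‖η (b p.2.1) (b p.2.2) (v p.1)‖ ^ 2 := by
  have h₁ (X) := oneFormNormSq_eq b v (F := F) (hη₂ X)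
  have h₂ : twoFormNormSq I F η =
      2⁻¹ * ∑ i, oneFormNormSq I F (η (stdOrthonormalBasis ℝ (TangentSpace I x) i)) := rfl
  simp only [h₂, h₁]
  rw [sum_sum_norm_sq_orthonormalBasis_eq (fun (p : κ × ι) X ↦ η X (b p.2) (v p.1))
    (fun p ↦ ⟨fun X Y ↦ by simp [(hη₁ _).map_add], fun r X ↦ by simp [(hη₁ _).map_smul]⟩) _ b]
  simp only [Fintype.sum_prod_type]
  rw [Finset.sum_comm]

variable [IsContMDiffRiemannianBundle I 1 E (fun x : M ↦ TangentSpace I x)]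
  [ContMDiffVectorBundle ∞ F V I] (A : CovariantDerivative I F V)

theorem gradOneFormNormSq_eq (α : Π x : M, TangentSpace I x →L[ℝ] V x →L[ℝ] V x) :
    gradOneFormNormSq A α x =
      ∑ i, ∑ p : κ × ι, ‖oneFormCov A α x (b i) (b p.2) (v p.1)‖ ^ 2 := by
  have h (X) := oneFormNormSq_eq b v (F := F) (α := fun Y ↦ oneFormCov A α x X Y)
    ⟨fun Y Z ↦ by simp, fun r Y ↦ by simp⟩
  simp only [gradOneFormNormSq, h]
  exact sum_sum_norm_sq_orthonormalBasis_eq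
    (fun (p : κ × ι) X ↦ oneFormCov A α x X (b p.2) (v p.1))
    (fun p ↦ ⟨fun X Y ↦ by simp, fun r X ↦ by simp⟩) _ b

theorem gradTwoFormNormSq_eq
    (η : Π x : M, TangentSpace I x →L[ℝ] TangentSpace I x →L[ℝ] V x →L[ℝ] V x) :
    gradTwoFormNormSq A η x =
      ∑ i, 2⁻¹ * ∑ p : κ × ι × ι, ‖twoFormCov A η x (b i) (b p.2.1) (b p.2.2) (v p.1)‖ ^ 2 := by
  have h (X) := twoFormNormSq_eq b v (F := F) (η := fun Y Z ↦ twoFormCov A η x X Y Z)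
    (fun Z ↦ ⟨fun Y Y' ↦ by simp, fun r Y ↦ by simp⟩)
    (fun Y ↦ ⟨fun Z Z' ↦ by simp, fun r Z ↦ by simp⟩)
  simp only [gradTwoFormNormSq, h, ← Finset.mul_sum]
  congr 1
  exact sum_sum_norm_sq_orthonormalBasis_eq
    (fun (p : κ × ι × ι) X ↦ twoFormCov A η x X (b p.2.1) (b p.2.2) (v p.1))
    (fun p ↦ ⟨fun X Y ↦ by simp, fun r X ↦ by simp⟩) _ b

/-- The divergence is a trace, so it can be read in the basis adapted to the gradient. -/
theorem codifferential_twoForm_apply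
    (η : Π x : M, TangentSpace I x →L[ℝ] TangentSpace I x →L[ℝ] V x →L[ℝ] V x)
    (Y : TangentSpace I x) (w : V x) :
    codifferential (U := fun x : M ↦ TangentSpace I x →L[ℝ] V x →L[ℝ] V x)
      (oneFormCov A) η x Y w = - ∑ i, twoFormCov A η x (b i) (b i) Y w := by
  let B : TangentSpace I x →ₗ[ℝ] TangentSpace I x →ₗ[ℝ] V x :=
    LinearMap.mk₂ ℝ (fun X Z ↦ twoFormCov A η x X Z Y w) (fun _ _ _ ↦ by simp)
      (fun _ _ _ ↦ by simp) (fun _ _ _ ↦ by simp) (fun _ _ _ ↦ by simp)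
  have h := sum_bilin_orthonormalBasis_eq B b (stdOrthonormalBasis ℝ (TangentSpace I x))
  simp only [B, LinearMap.mk₂_apply] at h
  rw [h, codifferential, neg_apply, neg_apply, sum_apply, sum_apply]
  rfl

theorem codifferential_oneForm_apply (α : Π x : M, TangentSpace I x →L[ℝ] V x →L[ℝ] V x)
    (w : V x) :
    codifferential (endCov A) α x w = - ∑ i, oneFormCov A α x (b i) (b i) w := by
  let B : TangentSpace I x →ₗ[ℝ] TangentSpace I x →ₗ[ℝ] V x :=
    LinearMap.mk₂ ℝ (fun X Z ↦ oneFormCov A α x X Z w) (fun _ _ _ ↦ by simp)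
      (fun _ _ _ ↦ by simp) (fun _ _ _ ↦ by simp) (fun _ _ _ ↦ by simp)
  have h := sum_bilin_orthonormalBasis_eq B b (stdOrthonormalBasis ℝ (TangentSpace I x))
  simp only [B, LinearMap.mk₂_apply] at h
  rw [h, codifferential, neg_apply, sum_apply]
  rfl

end NormFormulas

/-! ### The extended Kato inequalities -/

section ExtendedKato

variable {E : Type*} [NormedAddCommGroup E] [NormedSpace ℝ E] [FiniteDimensional ℝ E]
  {H : Type*} [TopologicalSpace H] {I : ModelWithCorners ℝ E H}
  {M : Type*} [TopologicalSpace M] [T2Space M] [ChartedSpace H M] [IsManifold I ∞ M]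
  [RiemannianBundle (fun x : M ↦ TangentSpace I x)]
  [IsContMDiffRiemannianBundle I 1 E (fun x : M ↦ TangentSpace I x)]

theorem isMetricAt_leviCivita (x : M) :
    IsMetricAt (F := E) (V := fun x : M ↦ TangentSpace I x) leviCivita x := by
  intro s t hs ht X₀
  have h := leviCivita_metric (X := extend E X₀) (mdifferentiableAt_extend ..) hs ht
  simpa only [extend_apply_self] using h

theorem exists_parallel_orthonormal_frame_leviCivita {x : M} {d : ℕ}
    (b : OrthonormalBasis (Fin d) ℝ (TangentSpace I x)) :
    ∃ e : Fin d → Π y : M, TangentSpace I y,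
      (∀ i, MDiffAt (T% (e i)) x ∧ leviCivita (e i) x = 0) ∧ (∀ i, e i x = b i) ∧
      ∀ᶠ y in 𝓝 x, ∃ c : OrthonormalBasis (Fin d) ℝ (TangentSpace I y), ∀ i, c i = e i y := by
  have hL : IsMetricAt (F := E) (V := fun x : M ↦ TangentSpace I x) leviCivita x :=
    isMetricAt_leviCivita x
  have h := @exists_parallel_orthonormal_frame E _ _ H _ I M _ _ E _ _
    (fun x : M ↦ TangentSpace I x) _ _ _ _ leviCivita x
  exact h hL b

variable {F : Type*} [NormedAddCommGroup F] [NormedSpace ℝ F] [FiniteDimensional ℝ F]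
  {V : M → Type*} [TopologicalSpace (TotalSpace F V)]
  [∀ x, NormedAddCommGroup (V x)] [∀ x, InnerProductSpace ℝ (V x)]
  [FiberBundle F V] [VectorBundle ℝ F V] [ContMDiffVectorBundle ∞ F V I]

section Swap

variable (A : CovariantDerivative I F V) [A.ContMDiffCovariantDerivative ∞]

/-- The connection acts on all bilinear forms, not only alternating ones, so antisymmetry of `∇F`
has to be deduced from that of `F` by the product rule. -/
theorem twoFormCov_curvature_swap (x : M) (X₀ Y₀ Z₀ : TangentSpace I x) :
    twoFormCov A (curvature A) x X₀ Y₀ Z₀ = - twoFormCov A (curvature A) x X₀ Z₀ Y₀ := by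
  obtain ⟨Y, hY, -, rfl⟩ := exists_contMDiff_extend I E Y₀
  obtain ⟨Z, hZ, -, rfl⟩ := exists_contMDiff_extend I E Z₀
  ext v
  obtain ⟨s, hs, -, rfl⟩ := exists_contMDiff_extend I F v
  have hYd : MDiffAt (T% Y) x := (hY x).mdifferentiableAt (by simp)
  have hZd : MDiffAt (T% Z) x := (hZ x).mdifferentiableAt (by simp)
  have hsd : MDiffAt (T% s) x := (hs x).mdifferentiableAt (by simp)
  have hF : MDiffAt (T% (fun y ↦ curvature A y (Z y) (Y y) (s y))) x :=
    (contMDiff_curvature_apply A hZ hY hs x).mdifferentiableAt (by simp)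
  have h : A (fun y ↦ curvature A y (Y y) (Z y) (s y)) x =
      - A (fun y ↦ curvature A y (Z y) (Y y) (s y)) x := by
    have h₀ := cov_sub A (mdifferentiableAt_zeroSection (E := V) ..) hF
    have hz : A (fun y ↦ (0 : V y)) x = 0 := by
      have : (fun y ↦ (0 : V y)) = 0 := rfl
      rw [this, A.zero]; rfl
    rw [hz, zero_sub] at h₀
    rw [← h₀]
    congr 1
    ext1 y
    rw [curvature_swap, neg_apply, zero_sub]
  rw [neg_apply, twoFormCov_apply A (mdifferentiableAt_curvature A x) _ hYd hZd hsd,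
    twoFormCov_apply A (mdifferentiableAt_curvature A x) _ hZd hYd hsd, h,
    curvature_swap A x (Y x) (Z x), curvature_swap A x (Y x) (leviCivita Z x X₀),
    curvature_swap A x (Z x) (leviCivita Y x X₀)]
  simp only [neg_apply]
  abel

theorem twoFormCov_curvature_self (x : M) (X₀ Y₀ : TangentSpace I x) :
    twoFormCov A (curvature A) x X₀ Y₀ Y₀ = 0 := by
  have h := twoFormCov_curvature_swap A x X₀ Y₀ Y₀
  rwa [eq_neg_iff_add_eq_zero, ← two_smul ℝ, smul_eq_zero_iff_right two_ne_zero] at h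

end Swap

variable [IsContMDiffRiemannianBundle I 1 F V] {A : CovariantDerivative I F V}
  {Φ : Π x : M, V x →L[ℝ] V x}

theorem isMetricAt_of_isMetricCompatible (hA : A.IsMetricCompatible) (x : M) :
    IsMetricAt A x := by
  have : ContMDiffVectorBundle 1 F V I := ContMDiffVectorBundle.of_le (n := ∞) (by simp)
  intro s t hs ht X₀
  have h := hA.mvfderiv_inner_eq (extend E X₀) hs ht
  simpa only [extend_apply_self] using h

variable [A.ContMDiffCovariantDerivative ∞]

/-- In frames parallel at `x` the derivatives of the components of `F` are the components of `∇F`,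
and near `x` the frames are orthonormal, so `|F|²` is half the sum of the squared components. -/
theorem sq_mvfderiv_curvatureNorm_le {x : M} (hA : IsMetricAt A x) {d m : ℕ}
    (b : OrthonormalBasis (Fin d) ℝ (TangentSpace I x)) (v : OrthonormalBasis (Fin m) ℝ (V x))
    (hF : curvature A x ≠ 0) :
    MDiffAt (curvatureNorm A) x ∧ ∀ X₀ : TangentSpace I x,
      mvfderiv I (curvatureNorm A) x X₀ ^ 2 ≤ 2⁻¹ * ∑ p : Fin m × Fin d × Fin d,
        ‖twoFormCov A (curvature A) x X₀ (b p.2.1) (b p.2.2) (v p.1)‖ ^ 2 := by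
  have : ContMDiffVectorBundle 1 F V I := ContMDiffVectorBundle.of_le (n := ∞) (by simp)
  obtain ⟨e, he, hex, heb⟩ := exists_parallel_orthonormal_frame_leviCivita b
  obtain ⟨s, hs, hsx, hsb⟩ := exists_parallel_orthonormal_frame hA v
  have hcov (X₀ : TangentSpace I x) (p : Fin m × Fin d × Fin d) :
      twoFormCov A (curvature A) x X₀ (b p.2.1) (b p.2.2) (v p.1) =
        A (fun y ↦ curvature A y (e p.2.1 y) (e p.2.2 y) (s p.1 y)) x X₀ := by
    rw [← hex, ← hex, ← hsx, twoFormCov_apply A (mdifferentiableAt_curvature A x) X₀ (he _).1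
      (he _).1 (hs _).1, (he _).2, (he _).2, (hs _).2]
    simp
  simp only [hcov]
  refine sq_mvfderiv_norm_le hA
    (f := fun (p : Fin m × Fin d × Fin d) y ↦ curvature A y (e p.2.1 y) (e p.2.2 y) (s p.1 y))
    (fun p ↦ ?_) (by norm_num) ?_ ?_
  · have h₁ := (mdifferentiableAt_curvature A x).clm_bundle_apply (F₁ := E)
      (F₂ := E →L[ℝ] F →L[ℝ] F) (E₂ := fun x : M ↦ TangentSpace I x →L[ℝ] V x →L[ℝ] V x)
      (he p.2.1).1
    have h₂ := h₁.clm_bundle_apply (F₁ := E)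
      (F₂ := F →L[ℝ] F) (E₂ := fun x : M ↦ V x →L[ℝ] V x) (he p.2.2).1
    exact h₂.clm_bundle_apply (F₁ := F) (F₂ := F) (hs p.1).1
  · filter_upwards [heb, hsb] with y ⟨b', hb'⟩ ⟨v', hv'⟩
    rw [curvatureNorm, twoFormNormSq_eq b' v' (fun Y ↦ ⟨fun X X' ↦ by simp, fun r X ↦ by simp⟩)
      (fun X ↦ ⟨fun Y Y' ↦ by simp, fun r Y ↦ by simp⟩)]
    simp only [hb', hv']
  · obtain ⟨p, hp⟩ : ∃ p : Fin m × Fin d × Fin d,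
        curvature A x (b p.2.1) (b p.2.2) (v p.1) ≠ 0 := by
      by_contra! h
      exact hF <| clm_eq_zero_of_orthonormalBasis b _ fun i ↦
        clm_eq_zero_of_orthonormalBasis b _ fun j ↦
          clm_eq_zero_of_orthonormalBasis v _ fun l ↦ h (l, i, j)
    refine Finset.sum_pos' (fun _ _ ↦ sq_nonneg _) ⟨p, Finset.mem_univ _, ?_⟩
    rw [hex, hex, hsx]
    have := norm_pos_iff.2 hp
    positivity

theorem sq_mvfderiv_higgsGradNorm_le {x : M} (hA : IsMetricAt A x)
    (hΦ : ContMDiff I (I.prod 𝓘(ℝ, F →L[ℝ] F)) ∞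
      (fun x ↦ (⟨x, Φ x⟩ : TotalSpace (F →L[ℝ] F) (fun x : M ↦ V x →L[ℝ] V x)))) {d m : ℕ}
    (b : OrthonormalBasis (Fin d) ℝ (TangentSpace I x)) (v : OrthonormalBasis (Fin m) ℝ (V x))
    (hdΦ : endCov A Φ x ≠ 0) :
    MDiffAt (higgsGradNorm A Φ) x ∧ ∀ X₀ : TangentSpace I x,
      mvfderiv I (higgsGradNorm A Φ) x X₀ ^ 2 ≤ ∑ p : Fin m × Fin d,
        ‖oneFormCov A (endCov A Φ) x X₀ (b p.2) (v p.1)‖ ^ 2 := by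
  have : ContMDiffVectorBundle 1 F V I := ContMDiffVectorBundle.of_le (n := ∞) (by simp)
  obtain ⟨e, he, hex, heb⟩ := exists_parallel_orthonormal_frame_leviCivita b
  obtain ⟨s, hs, hsx, hsb⟩ := exists_parallel_orthonormal_frame hA v
  have hcov (X₀ : TangentSpace I x) (p : Fin m × Fin d) :
      oneFormCov A (endCov A Φ) x X₀ (b p.2) (v p.1) =
        A (fun y ↦ endCov A Φ y (e p.2 y) (s p.1 y)) x X₀ := by
    rw [← hex, ← hsx, oneFormCov_apply A (mdifferentiableAt_endCov hΦ x) X₀ (he _).1 (hs _).1,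
      (he _).2, (hs _).2]
    simp
  simp only [hcov]
  have h := sq_mvfderiv_norm_le hA (c := 1) (N := higgsGradNorm A Φ)
    (f := fun (p : Fin m × Fin d) y ↦ endCov A Φ y (e p.2 y) (s p.1 y))
    (fun p ↦ ?_) one_pos ?_ ?_
  · simpa only [one_mul] using h
  · have h₁ := (mdifferentiableAt_endCov (A := A) hΦ x).clm_bundle_apply (F₁ := E)
      (F₂ := F →L[ℝ] F) (E₂ := fun x : M ↦ V x →L[ℝ] V x) (he p.2).1
    exact h₁.clm_bundle_apply (F₁ := F) (F₂ := F) (hs p.1).1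
  · filter_upwards [heb, hsb] with y ⟨b', hb'⟩ ⟨v', hv'⟩
    rw [higgsGradNorm, oneFormNormSq_eq b' v' ⟨fun X X' ↦ by simp, fun r X ↦ by simp⟩]
    simp only [hb', hv', one_mul]
  · obtain ⟨p, hp⟩ : ∃ p : Fin m × Fin d, endCov A Φ x (b p.2) (v p.1) ≠ 0 := by
      by_contra! h
      exact hdΦ <| clm_eq_zero_of_orthonormalBasis b _ fun i ↦
        clm_eq_zero_of_orthonormalBasis v _ fun l ↦ h (l, i)
    refine Finset.sum_pos' (fun _ _ ↦ sq_nonneg _) ⟨p, Finset.mem_univ _, ?_⟩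
    rw [hex, hsx]
    have := norm_pos_iff.2 hp
    positivity

theorem one_lt_finrank_of_curvature_ne_zero {x : M} (hF : curvature A x ≠ 0) :
    1 < Module.finrank ℝ (TangentSpace I x) := by
  let b := stdOrthonormalBasis ℝ (TangentSpace I x)
  by_contra! h
  have hsub : Subsingleton (Fin (Module.finrank ℝ (TangentSpace I x))) :=
    Fin.subsingleton_iff_le_one.2 h
  refine hF <| clm_eq_zero_of_orthonormalBasis b _ fun i ↦
    clm_eq_zero_of_orthonormalBasis b _ fun j ↦ ?_
  rw [Subsingleton.elim i j, curvature_self]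

theorem finrank_pos_of_endCov_ne_zero {x : M} (hdΦ : endCov A Φ x ≠ 0) :
    0 < Module.finrank ℝ (TangentSpace I x) := by
  by_contra! h
  have : IsEmpty (Fin (Module.finrank ℝ (TangentSpace I x))) :=
    ⟨fun i ↦ absurd i.2 (by omega)⟩
  exact hdΦ <| clm_eq_zero_of_orthonormalBasis (stdOrthonormalBasis ℝ (TangentSpace I x)) _
    fun i ↦ isEmptyElim i

theorem covectorNormSq_eq_of_adapted {x : M} {ξ : TangentSpace I x →L[ℝ] ℝ} {d : ℕ} {i₀ : Fin d}
    (b : OrthonormalBasis (Fin d) ℝ (TangentSpace I x)) (hb : ∀ i ≠ i₀, ξ (b i) = 0) :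
    covectorNormSq ξ = ξ (b i₀) ^ 2 := by
  rw [covectorNormSq_eq b, Finset.sum_eq_single i₀ (fun i _ hi ↦ by simp [hb i hi]) (by simp)]

/-- In the adapted basis only `∇_{i₀} F` enters the left side; the array inequality is applied for
each vector of an orthonormal basis of the fibre and summed. -/
theorem IsYangMillsHiggsPair.kato_curvature (h : IsYangMillsHiggsPair A Φ) {a : ℝ} (ha : 0 < a)
    {x : M} {n : ℕ} (hd : Module.finrank ℝ (TangentSpace I x) = n) (hF : curvature A x ≠ 0) :
    MDiffAt (curvatureNorm A) x ∧
      (1 + min (1 / 2) (a / (1 + ((n : ℝ) - 2) * a))) *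
          covectorNormSq (mvfderiv I (curvatureNorm A) x) ≤
        gradTwoFormNormSq A (curvature A) x
          + a * oneFormNormSq I F (fun X ↦ ⁅endCov A Φ x X, Φ x⁆) := by
  have hA : IsMetricAt A x := isMetricAt_of_isMetricCompatible h.metric x
  have : FiniteDimensional ℝ (V x) := VectorBundle.finiteDimensional ℝ F V x
  have hn : 2 ≤ n := hd ▸ one_lt_finrank_of_curvature_ne_zero hF
  obtain ⟨b, hb⟩ := exists_orthonormalBasis_covector_eq_zero hd
    ⟨0, by omega⟩ (mvfderiv I (curvatureNorm A) x)
  let v := stdOrthonormalBasis ℝ (V x)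
  obtain ⟨hN, hle⟩ := sq_mvfderiv_curvatureNorm_le hA b v hF
  refine ⟨hN, ?_⟩
  -- Linearity of the commutator one-form is inherited from `d^*F` through the field equation.
  rw [covectorNormSq_eq_of_adapted b hb, gradTwoFormNormSq_eq b v,
    oneFormNormSq_eq b v (by simp only [← h.codifferential_curvature]; exact ⟨by simp, by simp⟩)]
  have hn' : (2 : ℝ) ≤ n := by exact_mod_cast hn
  have hc : 0 ≤ 1 + min (1 / 2) (a / (1 + ((n : ℝ) - 2) * a)) := by
    have : 0 ≤ ((n : ℝ) - 2) * a := mul_nonneg (by linarith) ha.le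
    positivity
  refine (mul_le_mul_of_nonneg_left (hle _) hc).trans ?_
  -- The array lemma uses the divergence `∑ ∇_i F_{ik}`, which is `-d^*F`; hence the sign in `J`,
  -- invisible to the norm.
  have key := Finset.sum_le_sum fun l (_ : l ∈ Finset.univ) ↦ kato_twoForm_of_array
    (fun i j k ↦ twoFormCov A (curvature A) x (b i) (b j) (b k) (v l))
    (fun k ↦ - ⁅endCov A Φ x (b k), Φ x⁆ (v l))
    (fun i j k ↦ by rw [twoFormCov_curvature_swap, neg_apply])
    (fun i j ↦ by rw [twoFormCov_curvature_self, zero_apply])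
    (fun i j k ↦ by
      simpa using congrArg (fun L ↦ L (v l)) (bianchi A x (b i) (b j) (b k)))
    (fun k ↦ by
      rw [← h.codifferential_curvature, codifferential_twoForm_apply b, neg_neg])
    ha (by simpa using hn) ⟨0, by omega⟩
  simp only [Fintype.card_fin, norm_neg] at key
  refine (le_of_eq ?_).trans (key.trans_eq ?_)
  · simp only [Fintype.sum_prod_type, Finset.mul_sum]
  · simp only [Fintype.sum_prod_type, Finset.mul_sum, Finset.sum_add_distrib]
    rw [add_left_inj, Finset.sum_comm]

theorem IsYangMillsHiggsPair.kato_higgs (h : IsYangMillsHiggsPair A Φ) {a : ℝ} (ha : 0 < a)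
    {x : M} {n : ℕ} (hd : Module.finrank ℝ (TangentSpace I x) = n) (hdΦ : endCov A Φ x ≠ 0) :
    MDiffAt (higgsGradNorm A Φ) x ∧
      (1 + if n = 1 then a / (1 + a) else
          min (1 / ((n : ℝ) - 1)) (a / (1 + a))) *
          covectorNormSq (mvfderiv I (higgsGradNorm A Φ) x) ≤
        gradOneFormNormSq A (endCov A Φ) x
          + a * twoFormNormSq I F (fun X Y ↦ ⁅curvature A x X Y, Φ x⁆) := by
  have hA : IsMetricAt A x := isMetricAt_of_isMetricCompatible h.metric x
  have : FiniteDimensional ℝ (V x) := VectorBundle.finiteDimensional ℝ F V x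
  have hn : 0 < n := hd ▸ finrank_pos_of_endCov_ne_zero hdΦ
  obtain ⟨b, hb⟩ := exists_orthonormalBasis_covector_eq_zero hd
    ⟨0, hn⟩ (mvfderiv I (higgsGradNorm A Φ) x)
  let v := stdOrthonormalBasis ℝ (V x)
  obtain ⟨hN, hle⟩ := sq_mvfderiv_higgsGradNorm_le hA h.smooth b v hdΦ
  refine ⟨hN, ?_⟩
  rw [covectorNormSq_eq_of_adapted b hb, gradOneFormNormSq_eq b v]
  -- The commutator with the curvature is replaced by the antisymmetrised second derivative of `Φ`,
  -- the form of `B` in the array lemma.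
  simp only [← oneFormCov_endCov_sub A h.smooth]
  rw [twoFormNormSq_eq b v
    (fun Y ↦ ⟨fun X X' ↦ by simp; abel, fun r X ↦ by simp [smul_sub]⟩)
    (fun X ↦ ⟨fun Y Y' ↦ by simp; abel, fun r Y ↦ by simp [smul_sub]⟩)]
  have hn' : (1 : ℝ) ≤ n := by exact_mod_cast hn
  have hc : 0 ≤ 1 + if n = 1 then a / (1 + a) else min (1 / ((n : ℝ) - 1)) (a / (1 + a)) := by
    have : 0 ≤ (n : ℝ) - 1 := by linarith
    split_ifs <;> positivity
  refine (mul_le_mul_of_nonneg_left (hle _) hc).trans ?_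
  have key := Finset.sum_le_sum fun l (_ : l ∈ Finset.univ) ↦ kato_oneForm_of_array
    (fun i j ↦ oneFormCov A (endCov A Φ) x (b i) (b j) (v l))
    (fun i j ↦ (oneFormCov A (endCov A Φ) x (b i) (b j) -
      oneFormCov A (endCov A Φ) x (b j) (b i)) (v l))
    (fun i j ↦ rfl)
    (by
      rw [← neg_eq_zero, ← codifferential_oneForm_apply b, h.codifferential_higgs, zero_apply])
    ha ⟨0, hn⟩
  simp only [Fintype.card_fin] at key
  refine (le_of_eq ?_).trans (key.trans_eq ?_)
  · simp only [Fintype.sum_prod_type, Finset.mul_sum]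
  · simp only [Fintype.sum_prod_type, Finset.mul_sum, Finset.sum_add_distrib]
    rw [add_left_inj, Finset.sum_comm]

end ExtendedKato

end YangMillsHiggs

theorem mainTheorem6 {n : ℕ}
    -- a smooth Riemannian manifold `M` of dimension `n`
    {M : Type*} [TopologicalSpace M] [T2Space M] [ChartedSpace (EuclideanSpace ℝ (Fin n)) M]
    [IsManifold (𝓡 n) ∞ M]
    [RiemannianBundle (fun x : M ↦ TangentSpace (𝓡 n) x)]
    [IsContMDiffRiemannianBundle (𝓡 n) ∞ (EuclideanSpace ℝ (Fin n))
      (fun x : M ↦ TangentSpace (𝓡 n) x)]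
    -- a smooth Riemannian vector bundle `V` over `M`
    {F : Type*} [NormedAddCommGroup F] [NormedSpace ℝ F] [FiniteDimensional ℝ F]
    {V : M → Type*} [TopologicalSpace (TotalSpace F V)]
    [∀ x, NormedAddCommGroup (V x)] [∀ x, InnerProductSpace ℝ (V x)]
    [FiberBundle F V] [VectorBundle ℝ F V] [ContMDiffVectorBundle ∞ F V (𝓡 n)]
    [IsContMDiffRiemannianBundle (𝓡 n) ∞ F V]
    -- a Yang-Mills-Higgs pair `(A, Φ)` on `V`
    (A : CovariantDerivative (𝓡 n) F V) [A.ContMDiffCovariantDerivative ∞]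
    (Φ : Π x : M, V x →L[ℝ] V x)
    (hAΦ : IsYangMillsHiggsPair A Φ) (a : ℝ) (ha : 0 < a) :
    -- the extended Kato inequality for the curvature, at points where `F ≠ 0`
    (∀ x : M, curvature A x ≠ 0 →
      MDifferentiableAt (𝓡 n) 𝓘(ℝ, ℝ) (curvatureNorm A) x ∧
      gradTwoFormNormSq A (curvature A) x ≥
        (1 + min (1 / 2) (a / (1 + ((n : ℝ) - 2) * a))) *
          covectorNormSq (mvfderiv (𝓡 n) (curvatureNorm A) x)
        - a * oneFormNormSq (𝓡 n) F (fun X ↦ ⁅endCov A Φ x X, Φ x⁆)) ∧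
    -- the extended Kato inequality for `dΦ`, at points where `dΦ ≠ 0`;
    -- for `n = 1` the number `1 / (n - 1)` is read as `+∞`
    (∀ x : M, endCov A Φ x ≠ 0 →
      MDifferentiableAt (𝓡 n) 𝓘(ℝ, ℝ) (higgsGradNorm A Φ) x ∧
      gradOneFormNormSq A (endCov A Φ) x ≥
        (1 + if n = 1 then a / (1 + a) else min (1 / ((n : ℝ) - 1)) (a / (1 + a))) *
          covectorNormSq (mvfderiv (𝓡 n) (higgsGradNorm A Φ) x)
        - a * twoFormNormSq (𝓡 n) F (fun X Y ↦ ⁅curvature A x X Y, Φ x⁆)) := by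
  refine ⟨fun x hF ↦ ?_, fun x hdΦ ↦ ?_⟩
  · obtain ⟨hN, h⟩ := hAΦ.kato_curvature ha (x := x) (n := n) finrank_euclideanSpace_fin hF
    exact ⟨hN, sub_le_iff_le_add.2 h⟩
  · obtain ⟨hN, h⟩ := hAΦ.kato_higgs ha (x := x) (n := n) finrank_euclideanSpace_fin hdΦ
    exact ⟨hN, sub_le_iff_le_add.2 h⟩
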